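/- Theorem 4.1. Let $(\mathfrak H,(\cdot,\cdot))$ be a complex Hilbert space with a non-trivial fundamental symmetry $J$ (a bounded operator with $J=J^*$, $J^2=I$, $J\neq\pm I$), let $[x,y]=(Jx,y)$ and $\mathfrak H_\pm=\frac12(I\pm J)\mathfrak H$. Let $S$ be a closed, densely defined, symmetric operator in $\mathfrak H$ with $SJ=JS$ such that each of the restrictions $S_\pm=S\upharpoonright_{\mathfrak H_\pm}$, regarded as an operator in $\mathfrak H_\pm$, has deficiency indices $\langle 1,1\rangle$. Put $$\Sigma_J=\{A\supset S \mid A \text{ is self-adjoint with respect to } [\cdot,\cdot]\},$$ $$\mathfrak U=\{C \text{ a bounded operator on } \mathfrak H \mid C^2=I,\ JC>0,\ SC=CS\},$$ $$\Upsilon_J=\{A\in\Sigma_J\mid AJ=JA\},\qquad \Sigma_J^{st}=\{A\in\Sigma_J\mid \exists\, C\in\mathfrak U:\ AC=CA\},$$ $$\Upsilon_{\mathfrak U}=\{A\in\Sigma_J\mid AC=CA\ \ \forall\, C\in\mathfrak U\}.$$ If no operator in $\Sigma_J$ has empty resolvent set, then $$\Upsilon_{\mathfrak U}=\Upsilon_J=\Sigma_J^{st}.$$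 If, moreover, $S$ is simple (there is no nonzero closed subspace that reduces $S$ and in which the part of $S$ is self-adjoint), then $\mathfrak U=\{J\}$. -/

import Mathlib

namespace KreinExt

section General

variable {E : Type*} [NormedAddCommGroup E] [InnerProductSpace ℂ E]

/-- Densely defined operator. -/
def IsDenselyDefined (T : E →ₗ.[ℂ] E) : Prop :=
  Dense (T.domain : Set E)

/-- Symmetric operator: `(T x, y) = (x, T y)` for all `x, y ∈ D(T)`. -/
def IsSymmetricOp (T : E →ₗ.[ℂ] E) : Prop :=
  T.IsFormalAdjoint T

/-- The defect subspace `ker (T* - μ I)` of a densely defined operator `T`: all `y` such that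
`(T x, y) = (x, μ y)` for every `x ∈ D(T)`, that is, `y ∈ D(T*)` and `T* y = μ y`. -/
def defectSpace (T : E →ₗ.[ℂ] E) (μ : ℂ) : Submodule ℂ E where
  carrier := {y | ∀ x : T.domain, inner ℂ (T x) y = inner ℂ (x : E) (μ • y)}
  zero_mem' := by
    intro x
    simp
  add_mem' := by
    intro a b ha hb x
    rw [inner_add_right, ha x, hb x, smul_add, inner_add_right]
  smul_mem' := by
    intro c a ha x
    rw [inner_smul_right, ha x, smul_comm μ c a, inner_smul_right (x : E) (μ • a) c]

/-- The deficiency indices of `T` are `<m, n>`. -/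
def HasDeficiencyIndices (T : E →ₗ.[ℂ] E) (m n : ℕ) : Prop :=
  Module.rank ℂ (defectSpace T Complex.I) = m ∧ Module.rank ℂ (defectSpace T (-Complex.I)) = n

theorem mem_defectSpace_iff [CompleteSpace E] {T : E →ₗ.[ℂ] E} (hT : IsDenselyDefined T)
    (μ : ℂ) (y : E) : y ∈ defectSpace T μ ↔ (y, μ • y) ∈ T.adjoint.graph := by
  rw [LinearPMap.adjoint_graph_eq_graph_adjoint hT, Submodule.mem_adjoint_iff]
  constructor
  · intro h a b hab
    obtain ⟨x, rfl, rfl⟩ := (LinearPMap.mem_graph_iff T).1 hab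
    exact sub_eq_zero.2 (h x)
  · intro h x
    exact sub_eq_zero.1 (h x (T x) (T.mem_graph x))

/-- The operator `T` and the everywhere defined operator `C` commute, `T C = C T`, as an equality
of operators with domains `D(T C) = {x | C x ∈ D(T)}` and `D(C T) = D(T)`. -/
def CommutesWith (T : E →ₗ.[ℂ] E) (C : E →L[ℂ] E) : Prop :=
  (∀ x : E, C x ∈ T.domain ↔ x ∈ T.domain) ∧
    ∀ (x : E) (hx : x ∈ T.domain) (hCx : C x ∈ T.domain), T ⟨C x, hCx⟩ = C (T ⟨x, hx⟩)

/-- The resolvent set: all `μ` for which `T - μ I` is a bijection of `D(T)` onto the whole space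
with a bounded inverse. -/
def resolventSetOp (T : E →ₗ.[ℂ] E) : Set ℂ :=
  {μ | ∃ R : E →L[ℂ] E,
    (∀ x : T.domain, R (T x - μ • (x : E)) = x) ∧
    ∀ y : E, ∃ h : R y ∈ T.domain, T ⟨R y, h⟩ - μ • R y = y}

/-- The part of `T` in a subspace `L`, acting on all `x ∈ L ∩ D(T)` with `T x ∈ L`. When `L` is
invariant under `T`, it is the restriction of `T` to `L`, considered as an operator in `L`. -/
def part (T : E →ₗ.[ℂ] E) (L : Submodule ℂ E) : L →ₗ.[ℂ] L where
  domain :=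
    { carrier := {x | ∃ h : (x : E) ∈ T.domain, T ⟨x, h⟩ ∈ L}
      zero_mem' := ⟨T.domain.zero_mem, by
        have h : T ⟨((0 : L) : E), T.domain.zero_mem⟩ = 0 := T.map_zero
        rw [h]
        exact L.zero_mem⟩
      add_mem' := by
        rintro a b ⟨ha, ha'⟩ ⟨hb, hb'⟩
        refine ⟨T.domain.add_mem ha hb, ?_⟩
        have h : T ⟨((a + b : L) : E), T.domain.add_mem ha hb⟩ = T ⟨a, ha⟩ + T ⟨b, hb⟩ :=
          T.map_add ⟨a, ha⟩ ⟨b, hb⟩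
        rw [h]
        exact L.add_mem ha' hb'
      smul_mem' := by
        rintro c a ⟨ha, ha'⟩
        refine ⟨T.domain.smul_mem c ha, ?_⟩
        have h : T ⟨((c • a : L) : E), T.domain.smul_mem c ha⟩ = c • T ⟨a, ha⟩ :=
          T.map_smul c ⟨a, ha⟩
        rw [h]
        exact L.smul_mem c ha' }
  toFun :=
    { toFun := fun x => ⟨T ⟨x.1, x.2.1⟩, x.2.2⟩
      map_add' := by
        intro a b
        exact Subtype.ext (T.map_add ⟨a.1, a.2.1⟩ ⟨b.1, b.2.1⟩)
      map_smul' := by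
        intro c a
        exact Subtype.ext (T.map_smul c ⟨a.1, a.2.1⟩) }

/-- The closed subspace `L` reduces `T`: the orthogonal projection `P` onto `L` satisfies
`P T ⊆ T P`. -/
def Reduces (L : Submodule ℂ E) [L.HasOrthogonalProjection] (T : E →ₗ.[ℂ] E) : Prop :=
  ∀ x : T.domain, ∃ h : L.starProjection x ∈ T.domain,
    T ⟨L.starProjection x, h⟩ = L.starProjection (T x)

/-- A symmetric operator is simple if no nonzero closed subspace reduces it to a
self-adjoint operator. -/
def IsSimpleOp [CompleteSpace E] (T : E →ₗ.[ℂ] E) : Prop :=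
  ∀ (L : Submodule ℂ E) [CompleteSpace L], Reduces L T → IsSelfAdjoint (part T L) → L = ⊥

end General

section Krein

variable {H : Type*} [NormedAddCommGroup H] [InnerProductSpace ℂ H] [CompleteSpace H]

/-- A non-trivial fundamental symmetry: `J = J*`, `J² = I`, `J ≠ ± I`. -/
structure IsNontrivialFundamentalSymmetry (J : H →L[ℂ] H) : Prop where
  selfAdjoint : IsSelfAdjoint J
  sq : J * J = 1
  ne_one : J ≠ 1
  ne_neg_one : J ≠ -1

/-- `H₊ = ½ (I + J) H`. -/
noncomputable def plusSpace (J : H →L[ℂ] H) : Submodule ℂ H :=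
  LinearMap.range (((1 / 2 : ℂ) • (1 + J) : H →L[ℂ] H) : H →ₗ[ℂ] H)

/-- `H₋ = ½ (I - J) H`. -/
noncomputable def minusSpace (J : H →L[ℂ] H) : Submodule ℂ H :=
  LinearMap.range (((1 / 2 : ℂ) • (1 - J) : H →L[ℂ] H) : H →ₗ[ℂ] H)

/-- The indefinite inner product `[x, y] = (J x, y)`. -/
noncomputable def kreinForm (J : H →L[ℂ] H) (x y : H) : ℂ :=
  inner ℂ (J x) y

/-- `A` is `J`-self-adjoint: it is densely defined and equals its adjoint with respect to the
indefinite inner product, i.e. `y ∈ D(A)` and `A y = z` if and only if `[A x, y] = [x, z]` for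
all `x ∈ D(A)`. -/
def IsJSelfAdjoint (J : H →L[ℂ] H) (A : H →ₗ.[ℂ] H) : Prop :=
  IsDenselyDefined A ∧
    ∀ y z : H, (y, z) ∈ A.graph ↔
      ∀ x : A.domain, kreinForm J (A x) y = kreinForm J (x : H) z

/-- The bounded operator `B` satisfies `B > 0`. -/
def IsStrictlyPositiveOp (B : H →L[ℂ] H) : Prop :=
  B.IsPositive ∧ ∀ x : H, x ≠ 0 → 0 < (inner ℂ (B x) x).re

/-- `Σ_J`: all `J`-self-adjoint extensions of `S`. -/
def SigmaJ (J : H →L[ℂ] H) (S : H →ₗ.[ℂ] H) : Set (H →ₗ.[ℂ] H) :=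
  {A | S ≤ A ∧ IsJSelfAdjoint J A}

/-- `𝔘`: all bounded `C` with `C² = I`, `J C > 0` and `S C = C S`. -/
def USet (J : H →L[ℂ] H) (S : H →ₗ.[ℂ] H) : Set (H →L[ℂ] H) :=
  {C | C * C = 1 ∧ IsStrictlyPositiveOp (J * C) ∧ CommutesWith S C}

/-- `Υ_J`: all `A ∈ Σ_J` commuting with `J`. -/
def UpsilonJ (J : H →L[ℂ] H) (S : H →ₗ.[ℂ] H) : Set (H →ₗ.[ℂ] H) :=
  {A | A ∈ SigmaJ J S ∧ CommutesWith A J}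

/-- `Σ_J^{st}`: all `A ∈ Σ_J` commuting with some `C ∈ 𝔘`. -/
def SigmaJst (J : H →L[ℂ] H) (S : H →ₗ.[ℂ] H) : Set (H →ₗ.[ℂ] H) :=
  {A | A ∈ SigmaJ J S ∧ ∃ C ∈ USet J S, CommutesWith A C}

/-- `Υ_𝔘`: all `A ∈ Σ_J` commuting with every `C ∈ 𝔘`. -/
def UpsilonU (J : H →L[ℂ] H) (S : H →ₗ.[ℂ] H) : Set (H →ₗ.[ℂ] H) :=
  {A | A ∈ SigmaJ J S ∧ ∀ C ∈ USet J S, CommutesWith A C}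

end Krein

end KreinExt

/-! For `C ∈ 𝔘` put `B = JC - CJ`. As `JC` is self-adjoint and `CJ` is its inverse, `B` is
symmetric; it commutes with `S` and anticommutes with `J`. Hence `B` maps each defect space `ker (S*
- μ)` into itself and sends each of the two lines into which `J` splits it into the other, so that
`B² = k ≥ 0` there. Nearby defect spaces are not orthogonal, which makes `k` locally constant in
`μ`, thus constant on each open half-plane (`HasDefectSquare.of_isPreconnected`).

Suitable neutral vectors `y₁`, `y₂` in the defect spaces at `±i` give a `J`-self-adjoint restriction
of `S*` (`spanExtension`) whose domain contains every `f ∈ ker (S* - μ)` with `[f, y₁] = [f, y₂] =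
0`. If the constants of the two half-planes differ, defect spaces of opposite half-planes are
orthogonal and one of the two conditions is void. If they agree and `k > 0`, then `B/√k` is
isometric on defect spaces and the vectors `m + Bm/√k`, with `Jm = -m`, are mutually `J`-orthogonal.
Either way every nonreal `μ` becomes an eigenvalue and the resolvent set is empty. So the hypothesis
forces `k = 0` and `B = 0` on defect spaces. There `JC` is a strictly positive involution, hence the
identity, and `C = J` (`apply_eq_apply_of_mem_uSet`).

Every `A ∈ Σ_J` lies between `S` and `S*`. By von Neumann's decomposition `C - J` maps `D(S*)` into
`D(S)`, so `A` commutes with `C` exactly when it commutes with `J`. If `S` is simple, `C - J` is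
zero, because the orthogonal complement of its kernel reduces `S` to a self-adjoint operator. -/

namespace KreinExt

/-! ### Symmetric operators, ranges of `T - μ` and defect spaces. -/

section General

variable {E : Type*} [NormedAddCommGroup E] [InnerProductSpace ℂ E]

/-- The weak form of `y ∈ D(T*)`, `T* y = z`. -/
def IsAdjointPair (T : E →ₗ.[ℂ] E) (y z : E) : Prop :=
  ∀ x : T.domain, inner ℂ (T x) y = inner ℂ (x : E) z

theorem mem_defectSpace {T : E →ₗ.[ℂ] E} {μ : ℂ} {y : E} :
    y ∈ defectSpace T μ ↔ IsAdjointPair T y (μ • y) := Iff.rfl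

namespace IsAdjointPair

variable {T : E →ₗ.[ℂ] E} {y z y' z' : E}

theorem add (h : IsAdjointPair T y z) (h' : IsAdjointPair T y' z') :
    IsAdjointPair T (y + y') (z + z') := fun x => by
  rw [inner_add_right, inner_add_right, h x, h' x]

theorem sub (h : IsAdjointPair T y z) (h' : IsAdjointPair T y' z') :
    IsAdjointPair T (y - y') (z - z') := fun x => by
  rw [inner_sub_right, inner_sub_right, h x, h' x]

theorem smul (c : ℂ) (h : IsAdjointPair T y z) : IsAdjointPair T (c • y) (c • z) := fun x => by
  rw [inner_smul_right, inner_smul_right, h x]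

theorem of_mem (hT : IsSymmetricOp T) (g : T.domain) : IsAdjointPair T g (T g) :=
  fun x => hT x g

theorem unique (hT : IsDenselyDefined T) (h : IsAdjointPair T y z) (h' : IsAdjointPair T y z') :
    z = z' := by
  refine hT.eq_of_inner_right ℂ fun x hx => ?_
  rw [← h ⟨x, hx⟩, ← h' ⟨x, hx⟩]

theorem iff_mem_graph [CompleteSpace E] (hT : IsDenselyDefined T) :
    (y, z) ∈ T.adjoint.graph ↔ IsAdjointPair T y z := by
  rw [LinearPMap.adjoint_graph_eq_graph_adjoint hT, Submodule.mem_adjoint_iff]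
  constructor
  · intro h x
    exact sub_eq_zero.1 (h x (T x) (T.mem_graph x))
  · intro h a b hab
    obtain ⟨x, rfl, rfl⟩ := (LinearPMap.mem_graph_iff T).1 hab
    exact sub_eq_zero.2 (h x)

end IsAdjointPair

theorem IsSymmetricOp.abs_im_mul_norm_le {T : E →ₗ.[ℂ] E} (hT : IsSymmetricOp T) (μ : ℂ)
    (x : T.domain) : |μ.im| * ‖(x : E)‖ ≤ ‖T x - μ • (x : E)‖ := by
  have h1 : (inner ℂ (x : E) (T x)).im = 0 := by
    have h := hT x x
    rw [← inner_conj_symm] at h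
    exact Complex.conj_eq_iff_im.1 h
  have h2 : (inner ℂ (x : E) (T x - μ • (x : E))).im = -(μ.im * ‖(x : E)‖ ^ 2) := by
    rw [inner_sub_right, inner_smul_right, Complex.sub_im, h1, inner_self_eq_norm_sq_to_K]
    have : ((‖(x : E)‖ : ℂ) ^ 2) = ((‖(x : E)‖ ^ 2 : ℝ) : ℂ) := by push_cast; rfl
    erw [this]
    rw [Complex.mul_im, Complex.ofReal_re, Complex.ofReal_im]
    ring
  have h3 : |μ.im| * ‖(x : E)‖ ^ 2 ≤ ‖(x : E)‖ * ‖T x - μ • (x : E)‖ := by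
    calc |μ.im| * ‖(x : E)‖ ^ 2 = |(inner ℂ (x : E) (T x - μ • (x : E))).im| := by
          rw [h2, abs_neg, abs_mul, abs_of_nonneg (sq_nonneg ‖(x : E)‖)]
      _ ≤ ‖inner ℂ (x : E) (T x - μ • (x : E))‖ := Complex.abs_im_le_norm _
      _ ≤ _ := norm_inner_le_norm _ _
  rcases eq_or_lt_of_le (norm_nonneg (x : E)) with h0 | h0
  · rw [← h0, mul_zero]; exact norm_nonneg _
  · refine le_of_mul_le_mul_left ?_ h0
    linarith

/-- `x ↦ T x - μ x` as a linear map on the domain. -/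
def subSMul (T : E →ₗ.[ℂ] E) (μ : ℂ) : T.domain →ₗ[ℂ] E := T.toFun - μ • T.domain.subtype

theorem subSMul_apply (T : E →ₗ.[ℂ] E) (μ : ℂ) (x : T.domain) :
    subSMul T μ x = T x - μ • (x : E) := rfl

theorem isClosed_range_subSMul [CompleteSpace E] {T : E →ₗ.[ℂ] E} (hT : IsSymmetricOp T)
    (hc : T.IsClosed) {μ : ℂ} (hμ : μ.im ≠ 0) :
    IsClosed (LinearMap.range (subSMul T μ) : Set E) := by
  have : CompleteSpace T.graph := _root_.IsClosed.completeSpace_coe (hs := hc)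
  let F : T.graph →L[ℂ] E :=
    ((ContinuousLinearMap.snd ℂ E E) - μ • (ContinuousLinearMap.fst ℂ E E)).comp T.graph.subtypeL
  have hpos : 0 < |μ.im| := abs_pos.2 hμ
  -- With `N = ‖T x - μ x‖`, the constant adds up the bounds `‖x‖ ≤ N / |Im μ|` and `‖T x‖ ≤ N + ‖μ‖
  -- ‖x‖`. Closedness of the range then comes from completeness of the graph.
  have hF : AntilipschitzWith (1 + (1 + ‖μ‖₊) * ‖μ.im‖₊⁻¹) F := by
    refine AddMonoidHomClass.antilipschitz_of_bound F ?_
    rintro ⟨⟨a, b⟩, hab⟩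
    obtain ⟨x, rfl, rfl⟩ := (LinearPMap.mem_graph_iff T).1 hab
    have h1 := hT.abs_im_mul_norm_le μ x
    have hFx : F ⟨((x : E), T x), hab⟩ = T x - μ • (x : E) := rfl
    rw [hFx]
    set N := ‖T x - μ • (x : E)‖
    have hx : ‖(x : E)‖ ≤ |μ.im|⁻¹ * N := by
      rw [inv_mul_eq_div, le_div_iff₀ hpos]; linarith
    have hTx : ‖T x‖ ≤ N + ‖μ‖ * ‖(x : E)‖ := by
      rw [← norm_smul]
      calc ‖T x‖ = ‖(T x - μ • (x : E)) + μ • (x : E)‖ := by rw [sub_add_cancel]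
        _ ≤ _ := norm_add_le _ _
    have hN : 0 ≤ N := norm_nonneg _
    have hi : 0 ≤ |μ.im|⁻¹ * N := by positivity
    have hm : ‖μ‖ * ‖(x : E)‖ ≤ ‖μ‖ * (|μ.im|⁻¹ * N) := by gcongr
    have hm0 : 0 ≤ ‖μ‖ * (|μ.im|⁻¹ * N) := by positivity
    change max ‖(x : E)‖ ‖T x‖ ≤ _
    push_cast
    rw [Real.norm_eq_abs]
    refine max_le ?_ ?_ <;> nlinarith
  have hcl := hF.isClosed_range F.uniformContinuous
  convert hcl using 1
  ext z
  constructor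
  · rintro ⟨x, rfl⟩
    exact ⟨⟨((x : E), T x), T.mem_graph x⟩, rfl⟩
  · rintro ⟨⟨⟨a, b⟩, hab⟩, rfl⟩
    obtain ⟨x, rfl, rfl⟩ := (LinearPMap.mem_graph_iff T).1 hab
    exact ⟨x, rfl⟩

theorem mem_defectSpace_of_orthogonal {T : E →ₗ.[ℂ] E} {μ : ℂ} {h : E}
    (hh : ∀ x : T.domain, inner ℂ (T x - μ • (x : E)) h = 0) :
    h ∈ defectSpace T (starRingEnd ℂ μ) := fun x => by
  have := hh x
  rw [inner_sub_left, inner_smul_left, sub_eq_zero] at this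
  rw [this, inner_smul_right]

theorem inner_sub_smul_defect {T : E →ₗ.[ℂ] E} {μ ν : ℂ} {h : E} (hh : h ∈ defectSpace T ν)
    (x : T.domain) :
    inner ℂ (T x - μ • (x : E)) h = (ν - starRingEnd ℂ μ) * inner ℂ (x : E) h := by
  rw [inner_sub_left, inner_smul_left, hh x, inner_smul_right]
  ring

theorem exists_range_add_defect [CompleteSpace E] {T : E →ₗ.[ℂ] E} (hT : IsSymmetricOp T)
    (hc : T.IsClosed) {μ : ℂ} (hμ : μ.im ≠ 0) (z : E) :
    ∃ g : T.domain, ∃ h ∈ defectSpace T (starRingEnd ℂ μ), z = T g - μ • (g : E) + h := by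
  set K := LinearMap.range (subSMul T μ)
  have : CompleteSpace K := IsClosed.completeSpace_coe (hs := isClosed_range_subSMul hT hc hμ)
  obtain ⟨g, hg⟩ : K.starProjection z ∈ K := K.starProjection_apply_mem z
  refine ⟨g, z - K.starProjection z, mem_defectSpace_of_orthogonal fun x => ?_, ?_⟩
  · exact (K.mem_orthogonal _).1 (K.sub_starProjection_mem_orthogonal z) _ ⟨x, rfl⟩
  · rw [← hg, ← subSMul_apply, add_sub_cancel]

theorem exists_range_of_orthogonal_defect [CompleteSpace E] {T : E →ₗ.[ℂ] E}
    (hT : IsSymmetricOp T) (hc : T.IsClosed) {μ : ℂ} (hμ : μ.im ≠ 0) {z : E}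
    (hz : ∀ h ∈ defectSpace T (starRingEnd ℂ μ), inner ℂ h z = 0) :
    ∃ g : T.domain, T g - μ • (g : E) = z := by
  obtain ⟨g, h, hh, hzg⟩ := exists_range_add_defect hT hc hμ z
  have h0 : inner ℂ h h = 0 := by
    have h1 := hz h hh
    rw [hzg, inner_add_right, ← inner_conj_symm, inner_sub_smul_defect hh] at h1
    simpa using h1
  rw [inner_self_eq_zero] at h0
  exact ⟨g, by rw [hzg, h0, add_zero]⟩

/-- Von Neumann's decomposition `D(T*) = D(T) + ker (T* - i) + ker (T* + i)`. -/
theorem IsAdjointPair.exists_decomposition [CompleteSpace E] {T : E →ₗ.[ℂ] E}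
    (hT : IsSymmetricOp T) (hc : T.IsClosed) {y z : E} (h : IsAdjointPair T y z) :
    ∃ g : T.domain, ∃ a ∈ defectSpace T Complex.I, ∃ b ∈ defectSpace T (-Complex.I),
      y = g + a + b := by
  obtain ⟨g, a, ha, hz⟩ := exists_range_add_defect hT hc (μ := -Complex.I) (by simp)
    (z + Complex.I • y)
  rw [map_neg, Complex.conj_I, neg_neg] at ha
  -- Since `(T* + i)(c a) = 2 i c a`, the value `c = 1 / (2i)` makes `y - g - c a` a solution of
  -- `(T* + i) b = 0`.
  obtain ⟨c, hcI⟩ : ∃ c : ℂ, c * Complex.I = 1 / 2 := ⟨(2 * Complex.I)⁻¹, by field_simp⟩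
  refine ⟨g, c • a, Submodule.smul_mem _ _ ha, y - g - c • a, ?_, by abel⟩
  have h1 := (h.sub (IsAdjointPair.of_mem hT g)).sub ((mem_defectSpace.1 ha).smul c)
  rw [mem_defectSpace]
  convert h1 using 1
  have hz' : z = T g + Complex.I • (g : E) + a - Complex.I • y := by
    rw [eq_sub_iff_add_eq, hz, neg_smul, sub_neg_eq_add]
  rw [hz', smul_smul, hcI]
  rw [smul_sub, smul_sub, smul_smul, neg_mul, mul_comm Complex.I c, hcI]
  module

/-- Orthogonality gives `f = (T - μ̄) g`, whence `‖f‖² = |(lam - μ)(g, f)|`, while `|Im μ| ‖g‖ ≤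
‖f‖`. For close `lam` and `μ` this is possible only if `f = 0`. It replaces an analytic dependence
of the defect spaces on `μ`. -/
theorem eq_zero_of_orthogonal_defect [CompleteSpace E] {T : E →ₗ.[ℂ] E}
    (hT : IsSymmetricOp T) (hc : T.IsClosed) {lam μ : ℂ} (hd : ‖lam - μ‖ < |μ.im|) {f : E}
    (hf : f ∈ defectSpace T lam) (hperp : ∀ h ∈ defectSpace T μ, inner ℂ h f = 0) : f = 0 := by
  have hμ : (starRingEnd ℂ μ).im ≠ 0 := by
    have := (norm_nonneg _).trans_lt hd
    simpa using abs_pos.1 this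
  obtain ⟨g, hg⟩ := exists_range_of_orthogonal_defect hT hc hμ (z := f) (by simpa using hperp)
  have h1 := inner_sub_smul_defect (μ := starRingEnd ℂ μ) hf g
  rw [hg, Complex.conj_conj] at h1
  have h2 := hT.abs_im_mul_norm_le (starRingEnd ℂ μ) g
  rw [hg, Complex.conj_im, abs_neg] at h2
  have h3 : ‖f‖ ^ 2 ≤ ‖lam - μ‖ * (‖(g : E)‖ * ‖f‖) := by
    have h4 : ‖inner ℂ f f‖ = ‖f‖ ^ 2 := by
      rw [inner_self_eq_norm_sq_to_K]; simp
    rw [← h4, h1, norm_mul]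
    gcongr
    exact norm_inner_le_norm _ _
  by_contra hne
  have hfpos : 0 < ‖f‖ := norm_pos_iff.2 hne
  have hgpos : 0 < ‖(g : E)‖ := by
    by_contra h0
    have h0' : ‖(g : E)‖ = 0 := le_antisymm (not_lt.1 h0) (norm_nonneg _)
    rw [h0'] at h3
    nlinarith
  have h5 : ‖lam - μ‖ * (‖(g : E)‖ * ‖f‖) < |μ.im| * (‖(g : E)‖ * ‖f‖) := by gcongr
  nlinarith

end General

/-! ### Self-adjoint parts and simple operators. -/

section General

variable {E : Type*} [NormedAddCommGroup E] [InnerProductSpace ℂ E] [CompleteSpace E]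

theorem isSelfAdjoint_of_surjective {A : E →ₗ.[ℂ] E} (hd : IsDenselyDefined A)
    (hs : IsSymmetricOp A) (h1 : ∀ u : E, ∃ v : A.domain, A v - Complex.I • (v : E) = u)
    (h2 : ∀ u : E, ∃ v : A.domain, A v - -Complex.I • (v : E) = u) : IsSelfAdjoint A := by
  rw [LinearPMap.isSelfAdjoint_def]
  have hle : A ≤ A.adjoint := LinearPMap.IsFormalAdjoint.le_adjoint hd hs
  refine (LinearPMap.eq_of_le_of_domain_eq hle (le_antisymm hle.1 fun y hy => ?_)).symm
  have hy' : IsAdjointPair A y (A.adjoint ⟨y, hy⟩) :=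
    (IsAdjointPair.iff_mem_graph hd).1 (A.adjoint.mem_graph ⟨y, hy⟩)
  obtain ⟨x, hx⟩ := h1 (A.adjoint ⟨y, hy⟩ - Complex.I • y)
  have hyx := hy'.sub (IsAdjointPair.of_mem hs x)
  have hmem : y - x ∈ defectSpace A Complex.I := by
    rw [mem_defectSpace]
    convert hyx using 1
    rw [smul_sub, sub_eq_sub_iff_add_eq_add, add_comm, ← sub_eq_sub_iff_add_eq_add, ← hx]
  obtain ⟨v, hv⟩ := h2 (y - x)
  have h0 := inner_sub_smul_defect (μ := -Complex.I) hmem v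
  rw [hv] at h0
  simp only [map_neg, Complex.conj_I, neg_neg, sub_self, zero_mul, inner_self_eq_zero] at h0
  rw [sub_eq_zero.1 h0]
  exact x.2

/-- `K` maps `D(T)` into itself and commutes with `T` there. -/
def CommutesOnDomain (T : E →ₗ.[ℂ] E) (K : E →L[ℂ] E) : Prop :=
  ∀ x : T.domain, ∃ h : K x ∈ T.domain, T ⟨K x, h⟩ = K (T x)

variable {T : E →ₗ.[ℂ] E} {K : E →L[ℂ] E}

/-- A solution `v` of `(T - μ) v = u` exists as `u` is orthogonal to the defect space inside `ker
K`. To see `v ⊥ z` for `z ∈ ker K`, write `z = (T - μ̄) g + h`: then `(T - μ̄) K g = 0` forces `g ∈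
ker K`, and moving `T` across gives `(z, v) = (g, u) + (h, v) = 0`. -/
theorem exists_mem_ker_orthogonal (hs : IsSymmetricOp T) (hc : T.IsClosed)
    (hK : CommutesOnDomain T K) {μ : ℂ} (hμ : μ.im ≠ 0)
    (h1 : defectSpace T μ ≤ LinearMap.ker (K : E →ₗ[ℂ] E))
    (h2 : defectSpace T (starRingEnd ℂ μ) ≤ LinearMap.ker (K : E →ₗ[ℂ] E))
    {u : E} (hu : u ∈ (LinearMap.ker (K : E →ₗ[ℂ] E))ᗮ) :
    ∃ v : T.domain, (v : E) ∈ (LinearMap.ker (K : E →ₗ[ℂ] E))ᗮ ∧ T v - μ • (v : E) = u := by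
  rw [Submodule.mem_orthogonal] at hu
  obtain ⟨v, hv⟩ := exists_range_of_orthogonal_defect hs hc hμ (z := u)
    fun h hh => hu h (h2 hh)
  refine ⟨v, (Submodule.mem_orthogonal _ _).2 fun z hz => ?_, hv⟩
  have hμ' : (starRingEnd ℂ μ).im ≠ 0 := by simpa using hμ
  obtain ⟨g, h, hh, hzg⟩ := exists_range_add_defect hs hc hμ' z
  rw [Complex.conj_conj] at hh
  obtain ⟨hKg, hTKg⟩ := hK g
  have hg0 : K g = 0 := by
    have hz0 : K z = 0 := hz
    have hh0 : K h = 0 := h1 hh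
    have h3 : T ⟨K g, hKg⟩ - starRingEnd ℂ μ • K g = 0 := by
      rw [hTKg, ← map_smul, ← map_sub, ← hz0, hzg, map_add, hh0, add_zero]
    have h4 := hs.abs_im_mul_norm_le (starRingEnd ℂ μ) ⟨K g, hKg⟩
    rw [h3, norm_zero] at h4
    have h5 : 0 < |(starRingEnd ℂ μ).im| := abs_pos.2 hμ'
    exact norm_le_zero_iff.1 (nonpos_of_mul_nonpos_right h4 h5)
  have hgu : inner ℂ (g : E) u = 0 := hu g hg0
  have hhv : inner ℂ (v : E) h = 0 := by
    have h6 := inner_sub_smul_defect (μ := μ) hh v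
    rw [hv, ← inner_conj_symm, hu h (h1 hh), map_zero] at h6
    refine (mul_eq_zero.1 h6.symm).resolve_left fun h7 => hμ ?_
    exact Complex.conj_eq_iff_im.1 (sub_eq_zero.1 h7).symm
  rw [hzg, inner_add_left, ← inner_conj_symm h, hhv, map_zero, add_zero, inner_sub_left,
    inner_smul_left, Complex.conj_conj, hs g v, ← inner_smul_right, ← inner_sub_right, hv, hgu]

/-- If `K` commutes with a simple closed symmetric operator and vanishes on its defect subspaces,
then `K = 0`. -/
theorem IsSimpleOp.eq_zero_of_commutes (hs : IsSymmetricOp T) (hc : T.IsClosed)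
    (hsimple : IsSimpleOp T) (hK : CommutesOnDomain T K)
    (h1 : defectSpace T Complex.I ≤ LinearMap.ker (K : E →ₗ[ℂ] E))
    (h2 : defectSpace T (-Complex.I) ≤ LinearMap.ker (K : E →ₗ[ℂ] E)) : K = 0 := by
  set N := LinearMap.ker (K : E →ₗ[ℂ] E) with hN
  have hNc : IsClosed (N : Set E) := K.isClosed_ker
  have hI : ∀ u ∈ Nᗮ, ∃ v : T.domain, (v : E) ∈ Nᗮ ∧ T v - Complex.I • (v : E) = u :=
    fun u hu => exists_mem_ker_orthogonal hs hc hK (by simp) h1 (by simpa using h2) hu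
  have hI' : ∀ u ∈ Nᗮ, ∃ v : T.domain, (v : E) ∈ Nᗮ ∧ T v - -Complex.I • (v : E) = u :=
    fun u hu => exists_mem_ker_orthogonal hs hc hK (by simp) h2 (by simpa using h1) hu
  have hred : Reduces Nᗮ T := fun x => by
    set u := Nᗮ.starProjection (T x - Complex.I • (x : E)) with hu
    obtain ⟨v, hvL, hv⟩ := hI u (Nᗮ.starProjection_apply_mem _)
    -- It suffices that `x - v` is orthogonal to each `w = (T + i) w'` with `w' ∈ Nᗮ`; by symmetry
    -- this is the pairing of `(T - i) x - u`, which lies in `Nᗮᗮ`, with `w'`.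
    have hPx : Nᗮ.starProjection (x : E) = v := by
      refine Submodule.eq_starProjection_of_mem_of_inner_eq_zero hvL fun w hw => ?_
      obtain ⟨w', hw'L, hw'⟩ := hI' w hw
      have h3 := hs (x - v) w'
      have h4 : T (x - v) - Complex.I • ((x - v : T.domain) : E)
          = (T x - Complex.I • (x : E)) - u := by
        rw [← hv, T.map_sub, Submodule.coe_sub]; module
      have h5 : inner ℂ ((T x - Complex.I • (x : E)) - u) (w' : E) = 0 := by
        rw [← inner_conj_symm, (Submodule.mem_orthogonal _ _).1
          (Nᗮ.sub_starProjection_mem_orthogonal _) _ hw'L, map_zero]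
      rw [← h4, inner_sub_left, inner_smul_left, h3, Complex.conj_I] at h5
      rw [← hw', inner_sub_right, inner_smul_right, ← Submodule.coe_sub]
      exact h5
    refine ⟨by rw [hPx]; exact v.2, ?_⟩
    have h6 : T ⟨Nᗮ.starProjection (x : E), by rw [hPx]; exact v.2⟩ = T v := by
      congr 1
      exact Subtype.ext hPx
    rw [h6, ← sub_add_cancel (T v) (Complex.I • (v : E)), hv, hu, ← hPx, map_sub, map_smul,
      sub_add_cancel]
  have hsurj : ∀ μ : ℂ, (∀ u ∈ Nᗮ, ∃ v : T.domain, (v : E) ∈ Nᗮ ∧ T v - μ • (v : E) = u) →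
      ∀ u : Nᗮ, ∃ v : (part T Nᗮ).domain, part T Nᗮ v - μ • (v : Nᗮ) = u := by
    intro μ h u
    obtain ⟨v, hvL, hv⟩ := h u u.2
    refine ⟨⟨⟨v, hvL⟩, v.2, ?_⟩, Subtype.ext hv⟩
    change T v ∈ Nᗮ
    rw [← sub_add_cancel (T v) (μ • (v : E)), hv]
    exact Nᗮ.add_mem u.2 (Nᗮ.smul_mem _ hvL)
  have hps : IsSymmetricOp (part T Nᗮ) := fun x y => hs ⟨x.1, x.2.1⟩ ⟨y.1, y.2.1⟩
  have hpI := hsurj _ hI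
  have hpI' := hsurj _ hI'
  -- For `y` orthogonal to the domain, solve `y = (T + i) x` and `x = (T - i) v`; then `0 = (v, y) =
  -- (x, x)`.
  have hpd : IsDenselyDefined (part T Nᗮ) := by
    refine (Submodule.dense_iff_topologicalClosure_eq_top).2 ?_
    rw [Submodule.topologicalClosure_eq_top_iff, Submodule.eq_bot_iff]
    intro y hy
    rw [Submodule.mem_orthogonal] at hy
    obtain ⟨x, hx⟩ := hpI' y
    obtain ⟨v, hv⟩ := hpI x
    have h7 := hy v v.2
    rw [← hx, inner_sub_right, ← hps v x, inner_smul_right, ← Complex.conj_I, ← inner_smul_left,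
      ← inner_sub_left, hv, inner_self_eq_zero] at h7
    have h8 : x = 0 := Subtype.ext h7
    rw [← hx, h8]
    simp
  have hbot := hsimple Nᗮ hred (isSelfAdjoint_of_surjective hpd hps hpI hpI')
  have : CompleteSpace N := IsClosed.completeSpace_coe (hs := hNc)
  rw [Submodule.orthogonal_eq_bot_iff] at hbot
  ext x
  have : x ∈ N := hbot ▸ Submodule.mem_top
  exact this

end General

open Filter Topology

/-! ### Defect spaces split by `J`, and the constant value of `B²` on them. -/

section Krein

variable {H : Type*} [NormedAddCommGroup H] [InnerProductSpace ℂ H]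

theorem IsAdjointPair.map {S : H →ₗ.[ℂ] H} {K K' : H →L[ℂ] H} (hK : CommutesOnDomain S K)
    (hKK' : ∀ x y, inner ℂ (K x) y = inner ℂ x (K' y)) {y z : H} (h : IsAdjointPair S y z) :
    IsAdjointPair S (K' y) (K' z) := fun x => by
  obtain ⟨hKx, hSK⟩ := hK x
  rw [← hKK', ← hKK', ← hSK, h ⟨K x, hKx⟩]

theorem defectSpace_map {S : H →ₗ.[ℂ] H} {K K' : H →L[ℂ] H} (hK : CommutesOnDomain S K)
    (hKK' : ∀ x y, inner ℂ (K x) y = inner ℂ x (K' y)) {μ : ℂ} {y : H}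
    (h : y ∈ defectSpace S μ) : K' y ∈ defectSpace S μ := by
  have := (mem_defectSpace.1 h).map hK hKK'
  rwa [map_smul] at this

theorem CommutesOnDomain.sub {S : H →ₗ.[ℂ] H} {K L : H →L[ℂ] H} (hK : CommutesOnDomain S K)
    (hL : CommutesOnDomain S L) : CommutesOnDomain S (K - L) := fun x => by
  obtain ⟨h1, h2⟩ := hK x
  obtain ⟨h3, h4⟩ := hL x
  refine ⟨S.domain.sub_mem h1 h3, ?_⟩
  have := S.map_sub ⟨K x, h1⟩ ⟨L x, h3⟩
  rw [h2, h4] at this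
  exact this

theorem CommutesOnDomain.mul {S : H →ₗ.[ℂ] H} {K L : H →L[ℂ] H} (hK : CommutesOnDomain S K)
    (hL : CommutesOnDomain S L) : CommutesOnDomain S (K * L) := fun x => by
  obtain ⟨h1, h2⟩ := hL x
  obtain ⟨h3, h4⟩ := hK ⟨L x, h1⟩
  refine ⟨h3, ?_⟩
  rw [h2] at h4
  exact h4

theorem CommutesWith.commutesOnDomain {S : H →ₗ.[ℂ] H} {K : H →L[ℂ] H} (h : CommutesWith S K) :
    CommutesOnDomain S K := fun x => ⟨(h.1 x).2 x.2, h.2 x x.2 ((h.1 x).2 x.2)⟩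

/-- `f` spans the part of `ker (S* - μ)` on which `J` acts as multiplication by `ε`. -/
structure SpansDefect (J : H →L[ℂ] H) (S : H →ₗ.[ℂ] H) (ε μ : ℂ) (f : H) : Prop where
  ne_zero : f ≠ 0
  mem : f ∈ defectSpace S μ
  apply_eq : J f = ε • f
  span : ∀ g ∈ defectSpace S μ, J g = ε • g → ∃ c : ℂ, g = c • f

variable {J B : H →L[ℂ] H} {S : H →ₗ.[ℂ] H}

/-- The projection onto the eigenspace of `J` with eigenvalue `ε = ± 1`. -/
noncomputable def signProj (J : H →L[ℂ] H) (ε : ℂ) (h : H) : H := (1 / 2 : ℂ) • (h + ε • J h)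

theorem apply_signProj (hJJ : ∀ x, J (J x) = x) {ε : ℂ} (hε : ε * ε = 1) (h : H) :
    J (signProj J ε h) = ε • signProj J ε h := by
  simp only [signProj, map_smul, map_add, hJJ, smul_add, smul_smul]
  rw [show ε * (1 / 2 * ε) = 1 / 2 * (ε * ε) by ring, hε, add_comm, mul_comm ε, mul_one]

theorem inner_signProj (hJs : ∀ x y, inner ℂ (J x) y = inner ℂ x (J y)) {ε : ℂ}
    (hε : ε * ε = 1) (hε' : starRingEnd ℂ ε = ε) {f : H} (hf : J f = ε • f) (h : H) :
    inner ℂ (signProj J ε h) f = inner ℂ h f := by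
  rw [signProj, inner_smul_left, inner_add_left, inner_smul_left, hJs, hf, inner_smul_right,
    ← mul_assoc, hε', hε, one_mul]
  simp only [map_div₀, map_one, Complex.conj_ofNat]
  ring

theorem signProj_mem_defectSpace (hJs : ∀ x y, inner ℂ (J x) y = inner ℂ x (J y))
    (hSJ : CommutesOnDomain S J) (ε : ℂ) {μ : ℂ} {h : H} (hh : h ∈ defectSpace S μ) :
    signProj J ε h ∈ defectSpace S μ :=
  Submodule.smul_mem _ _ (Submodule.add_mem _ hh
    (Submodule.smul_mem _ _ (defectSpace_map hSJ hJs hh)))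

theorem signProj_add_signProj (h : H) : signProj J 1 h + signProj J (-1) h = h := by
  simp only [signProj]
  module

theorem mem_plusSpace_iff (hJJ : ∀ x, J (J x) = x) (x : H) :
    x ∈ plusSpace J ↔ J x = (1 : ℂ) • x := by
  constructor
  · rintro ⟨y, rfl⟩
    simp [hJJ, add_comm]
  · intro h
    refine ⟨x, ?_⟩
    simp only [ContinuousLinearMap.coe_coe, smul_apply, add_apply, one_apply_eq_self, h]
    module

theorem mem_minusSpace_iff (hJJ : ∀ x, J (J x) = x) (x : H) :
    x ∈ minusSpace J ↔ J x = (-1 : ℂ) • x := by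
  constructor
  · rintro ⟨y, rfl⟩
    simp [hJJ, ← smul_neg]
  · intro h
    refine ⟨x, ?_⟩
    simp only [ContinuousLinearMap.coe_coe, smul_apply, sub_apply, one_apply_eq_self, h]
    module

/-- A vector of `L` pairs with `x` as it does with the `J`-projection of `x` onto `L`, and this
projection commutes with `S`. So testing against `D(S) ∩ L` is enough. -/
theorem mem_defectSpace_part_iff (hJJ : ∀ x, J (J x) = x)
    (hJs : ∀ x y, inner ℂ (J x) y = inner ℂ x (J y)) (hSJ : CommutesOnDomain S J) {ε : ℂ}
    (hε : ε * ε = 1) (hε' : starRingEnd ℂ ε = ε) {L : Submodule ℂ H}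
    (hL : ∀ x, x ∈ L ↔ J x = ε • x) {μ : ℂ} (y : L) :
    y ∈ defectSpace (part S L) μ ↔ (y : H) ∈ defectSpace S μ := by
  refine ⟨fun h x => ?_, fun h x => h ⟨x.1, x.2.1⟩⟩
  have hy : J (y : H) = ε • (y : H) := (hL y).1 y.2
  obtain ⟨h1, h2⟩ := hSJ x
  have hSx : S ((1 / 2 : ℂ) • (x + ε • ⟨J x, h1⟩)) = signProj J ε (S x) := by
    rw [S.map_smul, S.map_add, S.map_smul, h2, signProj]
  have hdom : signProj J ε (x : H) ∈ S.domain :=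
    ((1 / 2 : ℂ) • (x + ε • (⟨J x, h1⟩ : S.domain))).2
  have hp : signProj J ε (x : H) ∈ L := (hL _).2 (apply_signProj hJJ hε _)
  have hSp : S ⟨signProj J ε (x : H), hdom⟩ = signProj J ε (S x) := hSx
  have h3 := h ⟨⟨signProj J ε (x : H), hp⟩, hdom, by
    rw [hSp]; exact (hL _).2 (apply_signProj hJJ hε _)⟩
  change inner ℂ (S ⟨signProj J ε (x : H), hdom⟩) (y : H)
    = inner ℂ (signProj J ε (x : H)) (μ • (y : H)) at h3
  rwa [hSp, inner_signProj hJs hε hε' hy, inner_smul_right, inner_signProj hJs hε hε' hy,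
    ← inner_smul_right] at h3

theorem exists_spansDefect (hJJ : ∀ x, J (J x) = x)
    (hJs : ∀ x y, inner ℂ (J x) y = inner ℂ x (J y)) (hSJ : CommutesOnDomain S J) {ε : ℂ}
    (hε : ε * ε = 1) (hε' : starRingEnd ℂ ε = ε) {L : Submodule ℂ H}
    (hL : ∀ x, x ∈ L ↔ J x = ε • x) {μ : ℂ}
    (hr : Module.rank ℂ (defectSpace (part S L) μ) = 1) : ∃ f, SpansDefect J S ε μ f := by
  obtain ⟨v, hv0, hv⟩ := rank_eq_one_iff.1 hr
  refine ⟨v.1, ?_, (mem_defectSpace_part_iff hJJ hJs hSJ hε hε' hL v.1).1 v.2, (hL _).1 v.1.2, ?_⟩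
  · intro h
    exact hv0 (Subtype.ext (Subtype.ext h))
  · intro g hg hJg
    obtain ⟨c, hc⟩ := hv ⟨⟨g, (hL g).2 hJg⟩,
      (mem_defectSpace_part_iff hJJ hJs hSJ hε hε' hL ⟨g, (hL g).2 hJg⟩).2 hg⟩
    refine ⟨c, ?_⟩
    have h1 := congrArg (fun w : defectSpace (part S L) μ => ((w : L) : H)) hc
    exact h1.symm

theorem SpansDefect.exists_near [CompleteSpace H] (hJJ : ∀ x, J (J x) = x)
    (hJs : ∀ x y, inner ℂ (J x) y = inner ℂ x (J y)) (hSs : IsSymmetricOp S) (hSc : S.IsClosed)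
    (hSJ : CommutesOnDomain S J) {ε : ℂ} (hε : ε * ε = 1) (hε' : starRingEnd ℂ ε = ε)
    {μ lam : ℂ} (h1 : ‖lam - μ‖ < |μ.im|) (h2 : ‖μ - lam‖ < |lam.im|) {f : H}
    (hf : SpansDefect J S ε μ f) :
    ∃ f', SpansDefect J S ε lam f' ∧ inner ℂ f f' ≠ 0 := by
  obtain ⟨h, hh, hne⟩ : ∃ h ∈ defectSpace S lam, inner ℂ h f ≠ 0 := by
    by_contra! hcon
    exact hf.ne_zero (eq_zero_of_orthogonal_defect hSs hSc h2 hf.mem hcon)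
  have hin : inner ℂ f (signProj J ε h) ≠ 0 := by
    rw [← inner_conj_symm, inner_signProj hJs hε hε' hf.apply_eq]
    exact (map_ne_zero _).2 hne
  refine ⟨signProj J ε h, ⟨?_, signProj_mem_defectSpace hJs hSJ ε hh,
    apply_signProj hJJ hε h, ?_⟩, hin⟩
  · intro h0
    exact hin (by rw [h0, inner_zero_right])
  · intro g hg hJg
    set f' := signProj J ε h
    -- This `c` makes `g - c f'` orthogonal to `f`, hence to all of `ker (S* - μ)`, so it must
    -- vanish.
    set c := inner ℂ f g / inner ℂ f f'
    refine ⟨c, sub_eq_zero.1 (eq_zero_of_orthogonal_defect hSs hSc h1 (Submodule.sub_mem _ hg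
      (Submodule.smul_mem _ c (signProj_mem_defectSpace hJs hSJ ε hh))) fun a ha => ?_)⟩
    have hJd : J (g - c • f') = ε • (g - c • f') := by
      rw [map_sub, map_smul, hJg, apply_signProj hJJ hε, smul_sub, smul_comm c]
    obtain ⟨d, hd⟩ := hf.span _ (signProj_mem_defectSpace hJs hSJ ε ha) (apply_signProj hJJ hε a)
    rw [← inner_signProj hJs hε hε' hJd, hd, inner_smul_left, inner_sub_right, inner_smul_right,
      div_mul_cancel₀ _ hin, sub_self, mul_zero]

theorem exists_eq_add (hJJ : ∀ x, J (J x) = x)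
    (hJs : ∀ x y, inner ℂ (J x) y = inner ℂ x (J y)) (hSJ : CommutesOnDomain S J) {μ : ℂ}
    {p m : H} (hp : SpansDefect J S 1 μ p) (hm : SpansDefect J S (-1) μ m) {f : H}
    (hf : f ∈ defectSpace S μ) : ∃ a b : ℂ, f = a • p + b • m := by
  obtain ⟨a, ha⟩ := hp.span _ (signProj_mem_defectSpace hJs hSJ 1 hf)
    (apply_signProj hJJ (by norm_num) f)
  obtain ⟨b, hb⟩ := hm.span _ (signProj_mem_defectSpace hJs hSJ (-1) hf)
    (apply_signProj hJJ (by norm_num) f)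
  exact ⟨a, b, by rw [← ha, ← hb, signProj_add_signProj]⟩

/-- The defect subspaces of `S` in the eigenspaces of `J` are lines, and `B² = k` on
`ker (S* - μ)`. -/
def HasDefectSquare (J B : H →L[ℂ] H) (S : H →ₗ.[ℂ] H) (k : ℝ) (μ : ℂ) : Prop :=
  (∃ p, SpansDefect J S 1 μ p) ∧ (∃ m, SpansDefect J S (-1) μ m) ∧
    ∀ f ∈ defectSpace S μ, B (B f) = (k : ℂ) • f

/-- Anticommutation gives `B m = b p` and `B p = c m`, so `B² = b c`; symmetry of `B` identifies `b
c` with `‖B p‖² / ‖p‖²`. -/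
theorem exists_hasDefectSquare (hJJ : ∀ x, J (J x) = x)
    (hJs : ∀ x y, inner ℂ (J x) y = inner ℂ x (J y)) (hSJ : CommutesOnDomain S J)
    (hBs : ∀ x y, inner ℂ (B x) y = inner ℂ x (B y)) (hSB : CommutesOnDomain S B)
    (hJB : ∀ x, J (B x) = -B (J x)) {μ : ℂ} {p m : H} (hp : SpansDefect J S 1 μ p)
    (hm : SpansDefect J S (-1) μ m) : ∃ k : ℝ, 0 ≤ k ∧ HasDefectSquare J B S k μ := by
  obtain ⟨b, hb⟩ := hp.span _ (defectSpace_map hSB hBs hm.mem)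
    (by rw [hJB, hm.apply_eq, map_smul]; module)
  obtain ⟨c, hc⟩ := hm.span _ (defectSpace_map hSB hBs hp.mem)
    (by rw [hJB, hp.apply_eq, map_smul]; module)
  have hBB : ∀ f ∈ defectSpace S μ, B (B f) = (b * c) • f := fun f hf => by
    obtain ⟨x, y, rfl⟩ := exists_eq_add hJJ hJs hSJ hp hm hf
    simp only [map_add, map_smul, hb, hc]
    module
  have hp2 : 0 < ‖p‖ ^ 2 := pow_pos (norm_pos_iff.2 hp.ne_zero) 2
  have hk : b * c = ((‖B p‖ ^ 2 / ‖p‖ ^ 2 : ℝ) : ℂ) := by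
    have h1 : inner ℂ (B p) (B p) = (b * c) * inner ℂ p p := by
      rw [hBs, hBB p hp.mem, inner_smul_right]
    rw [inner_self_eq_norm_sq_to_K, inner_self_eq_norm_sq_to_K] at h1
    have h2 : (b * c) * ((‖p‖ ^ 2 : ℝ) : ℂ) = ((‖B p‖ ^ 2 : ℝ) : ℂ) := by
      push_cast; exact h1.symm
    rw [Complex.ofReal_div, eq_div_iff (by exact_mod_cast hp2.ne'), h2]
  exact ⟨‖B p‖ ^ 2 / ‖p‖ ^ 2, by positivity, ⟨p, hp⟩, ⟨m, hm⟩, fun f hf => by rw [hBB f hf, hk]⟩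

theorem HasDefectSquare.near [CompleteSpace H] (hJJ : ∀ x, J (J x) = x)
    (hJs : ∀ x y, inner ℂ (J x) y = inner ℂ x (J y)) (hSs : IsSymmetricOp S) (hSc : S.IsClosed)
    (hSJ : CommutesOnDomain S J) (hBs : ∀ x y, inner ℂ (B x) y = inner ℂ x (B y))
    (hSB : CommutesOnDomain S B) (hJB : ∀ x, J (B x) = -B (J x)) {k : ℝ}
    {μ lam : ℂ} (h1 : ‖lam - μ‖ < |μ.im|) (h2 : ‖μ - lam‖ < |lam.im|)
    (h : HasDefectSquare J B S k μ) : HasDefectSquare J B S k lam := by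
  obtain ⟨⟨p, hp⟩, ⟨m, hm⟩, hk⟩ := h
  obtain ⟨p', hp', hne⟩ := hp.exists_near hJJ hJs hSs hSc hSJ (by norm_num) (by simp) h1 h2
  obtain ⟨m', hm', -⟩ := hm.exists_near hJJ hJs hSs hSc hSJ (by norm_num) (by simp) h1 h2
  obtain ⟨k', -, hk'⟩ := exists_hasDefectSquare hJJ hJs hSJ hBs hSB hJB hp' hm'
  -- Evaluating on both sides gives `k' (p, p') = k (p, p')` with `(p, p') ≠ 0`.
  have h3 : inner ℂ p (B (B p')) = inner ℂ (B (B p)) p' := by rw [hBs, hBs]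
  rw [hk p hp.mem, hk'.2.2 p' hp'.mem, inner_smul_right, inner_smul_left, Complex.conj_ofReal] at h3
  have h4 := Complex.ofReal_injective (mul_right_cancel₀ hne h3)
  rwa [h4] at hk'

theorem HasDefectSquare.of_isPreconnected [CompleteSpace H] (hJJ : ∀ x, J (J x) = x)
    (hJs : ∀ x y, inner ℂ (J x) y = inner ℂ x (J y)) (hSs : IsSymmetricOp S) (hSc : S.IsClosed)
    (hSJ : CommutesOnDomain S J) (hBs : ∀ x y, inner ℂ (B x) y = inner ℂ x (B y))
    (hSB : CommutesOnDomain S B) (hJB : ∀ x, J (B x) = -B (J x)) {k : ℝ} {s : Set ℂ}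
    (hs : IsPreconnected s) (hs0 : ∀ μ ∈ s, μ.im ≠ 0) {μ lam : ℂ} (hμ : μ ∈ s) (hlam : lam ∈ s)
    (h : HasDefectSquare J B S k μ) : HasDefectSquare J B S k lam := by
  refine (hs.induction₂ (fun x y => HasDefectSquare J B S k x ↔ HasDefectSquare J B S k y)
    (fun x hx => ?_) (fun _ _ _ _ _ _ hxy hyz => hxy.trans hyz) (fun _ _ _ _ hxy => hxy.symm)
    hμ hlam).1 h
  have e1 : ∀ᶠ y in 𝓝 x, ‖y - x‖ < |x.im| := by
    refine ContinuousAt.eventually_lt (by fun_prop) continuousAt_const ?_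
    simpa using hs0 x hx
  have e2 : ∀ᶠ y in 𝓝 x, ‖x - y‖ < |y.im| := by
    refine ContinuousAt.eventually_lt (by fun_prop)
      (Complex.continuous_im.abs.continuousAt) ?_
    simpa using hs0 x hx
  filter_upwards [nhdsWithin_le_nhds e1, nhdsWithin_le_nhds e2] with y hy1 hy2
  exact ⟨fun h => h.near hJJ hJs hSs hSc hSJ hBs hSB hJB hy1 hy2,
    fun h => h.near hJJ hJs hSs hSc hSJ hBs hSB hJB hy2 hy1⟩

end Krein

/-! ### The `J`-self-adjoint extension built from two neutral defect vectors. -/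

section Krein

variable {H : Type*} [NormedAddCommGroup H] [InnerProductSpace ℂ H]

variable {J : H →L[ℂ] H} {S : H →ₗ.[ℂ] H} {y₁ y₂ : H}

theorem mem_sup_span_pair_iff {D : Submodule ℂ H} {f : H} :
    f ∈ D ⊔ Submodule.span ℂ {y₁, y₂} ↔ ∃ g : D, ∃ a b : ℂ, f = g + (a • y₁ + b • y₂) := by
  rw [Submodule.mem_sup]
  constructor
  · rintro ⟨g, hg, w, hw, rfl⟩
    obtain ⟨a, b, rfl⟩ := Submodule.mem_span_pair.1 hw
    exact ⟨⟨g, hg⟩, a, b, rfl⟩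
  · rintro ⟨g, a, b, rfl⟩
    exact ⟨g, g.2, _, Submodule.mem_span_pair.2 ⟨a, b, rfl⟩, rfl⟩

theorem IsAdjointPair.kreinForm_domain (hJs : ∀ x y, inner ℂ (J x) y = inner ℂ x (J y))
    (hSJ : CommutesOnDomain S J) {f z : H} (h : IsAdjointPair S f z) (g : S.domain) :
    kreinForm J z g = kreinForm J f (S g) := by
  obtain ⟨h1, h2⟩ := hSJ g
  have h3 := h ⟨J g, h1⟩
  rw [h2] at h3
  rw [kreinForm, kreinForm, hJs, hJs, ← inner_conj_symm, ← h3, inner_conj_symm]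

theorem kreinForm_conj_symm (hJs : ∀ x y, inner ℂ (J x) y = inner ℂ x (J y)) (x y : H) :
    starRingEnd ℂ (kreinForm J y x) = kreinForm J x y := by
  rw [kreinForm, kreinForm, hJs, inner_conj_symm]

theorem kreinForm_add_left (x y z : H) :
    kreinForm J (x + y) z = kreinForm J x z + kreinForm J y z := by
  rw [kreinForm, map_add, inner_add_left]; rfl

theorem kreinForm_add_right (x y z : H) :
    kreinForm J x (y + z) = kreinForm J x y + kreinForm J x z := inner_add_right _ _ _

theorem kreinForm_smul_left (c : ℂ) (x y : H) :
    kreinForm J (c • x) y = starRingEnd ℂ c * kreinForm J x y := by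
  rw [kreinForm, map_smul, inner_smul_left]; rfl

theorem kreinForm_smul_right (c : ℂ) (x y : H) :
    kreinForm J x (c • y) = c * kreinForm J x y := inner_smul_right _ _ _

/-- A bounded inverse at `μ`, real or not, excludes eigenvalues within `1 / ‖R‖` of `μ`, and nonreal
points lie in every such disc. -/
theorem resolventSetOp_eq_empty {A : H →ₗ.[ℂ] H}
    (hA : ∀ μ : ℂ, μ.im ≠ 0 → ∃ f, f ≠ 0 ∧ (f, μ • f) ∈ A.graph) : resolventSetOp A = ∅ := by
  rw [Set.eq_empty_iff_forall_notMem]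
  rintro μ ⟨R, hR, -⟩
  obtain ⟨t, ht0, htR, ht⟩ : ∃ t : ℝ, 0 < t ∧ t * ‖R‖ < 1 ∧ (μ + t * Complex.I).im ≠ 0 := by
    have hpos : 0 < (‖R‖ + 1)⁻¹ := by positivity
    have hb : (‖R‖ + 1)⁻¹ * ‖R‖ < 1 := by
      rw [inv_mul_lt_iff₀ (by positivity)]; linarith
    have him : ∀ t : ℝ, (μ + t * Complex.I).im = μ.im + t := fun t => by simp
    -- Halving the shift avoids the single value for which `μ + t i` would be real.
    by_cases h : μ.im + (‖R‖ + 1)⁻¹ = 0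
    · refine ⟨(‖R‖ + 1)⁻¹ / 2, by positivity, ?_, ?_⟩
      · nlinarith [norm_nonneg R]
      · rw [him]; intro h0; linarith
    · exact ⟨_, hpos, hb, by rwa [him]⟩
  obtain ⟨f, hf0, hf⟩ := hA _ ht
  obtain ⟨x, rfl, hx⟩ := (LinearPMap.mem_graph_iff A).1 hf
  have h1 := hR x
  have h2 : A x - μ • (x : H) = ((t : ℂ) * Complex.I) • (x : H) := by
    have hx' : A x = (μ + t * Complex.I) • (x : H) := hx
    rw [hx']; module
  rw [h2, map_smul] at h1
  have h3 : ‖(x : H)‖ ≤ t * (‖R‖ * ‖(x : H)‖) := by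
    calc ‖(x : H)‖ = ‖((t : ℂ) * Complex.I) • R x‖ := by rw [h1]
      _ = t * ‖R x‖ := by
        rw [norm_smul, norm_mul, Complex.norm_I, mul_one, Complex.norm_real, Real.norm_eq_abs,
          abs_of_pos ht0]
      _ ≤ _ := by gcongr; exact R.le_opNorm _
  have h4 : 0 < ‖(x : H)‖ := norm_pos_iff.2 hf0
  nlinarith

variable [CompleteSpace H]

/-- The restriction of `S*` to `D(S) + span {y₁, y₂}`. -/
noncomputable def spanExtension (S : H →ₗ.[ℂ] H) (y₁ y₂ : H) : H →ₗ.[ℂ] H :=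
  S.adjoint.domRestrict (S.domain ⊔ Submodule.span ℂ {y₁, y₂})

theorem mem_graph_spanExtension (hSd : IsDenselyDefined S) {f z : H} :
    (f, z) ∈ (spanExtension S y₁ y₂).graph ↔
      f ∈ S.domain ⊔ Submodule.span ℂ {y₁, y₂} ∧ IsAdjointPair S f z := by
  rw [← IsAdjointPair.iff_mem_graph hSd]
  constructor
  · intro h
    obtain ⟨x, rfl, rfl⟩ := (LinearPMap.mem_graph_iff _).1 h
    refine ⟨x.2.1, ?_⟩
    exact S.adjoint.mem_graph ⟨x.1, x.2.2⟩
  · rintro ⟨hf, h⟩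
    obtain ⟨x, rfl, rfl⟩ := (LinearPMap.mem_graph_iff _).1 h
    exact (spanExtension S y₁ y₂).mem_graph ⟨x, hf, x.2⟩

/-- For neutral `y₁ ∈ ker (S* - i)` and `y₂ ∈ ker (S* + i)` which span their `J`-orthogonal
companions, `D(S) + span {y₁, y₂}` is cut out of `D(S*)` by two boundary conditions. -/
theorem mem_spanExtension_domain_iff (hSd : IsDenselyDefined S) (hSs : IsSymmetricOp S)
    (hSc : S.IsClosed) (hJs : ∀ x y, inner ℂ (J x) y = inner ℂ x (J y))
    (hSJ : CommutesOnDomain S J)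
    (hy₁ : y₁ ∈ defectSpace S Complex.I) (hy₂ : y₂ ∈ defectSpace S (-Complex.I))
    (hn₁ : kreinForm J y₁ y₁ = 0) (hn₂ : kreinForm J y₂ y₂ = 0)
    (hs₁ : ∀ a ∈ defectSpace S Complex.I, kreinForm J a y₁ = 0 → ∃ c : ℂ, a = c • y₁)
    (hs₂ : ∀ a ∈ defectSpace S (-Complex.I), kreinForm J a y₂ = 0 → ∃ c : ℂ, a = c • y₂)
    {f z : H} (hfz : IsAdjointPair S f z) :
    f ∈ S.domain ⊔ Submodule.span ℂ {y₁, y₂} ↔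
      kreinForm J z y₁ = kreinForm J f (Complex.I • y₁) ∧
      kreinForm J z y₂ = kreinForm J f (-Complex.I • y₂) := by
  obtain ⟨g, a, ha, b, hb, rfl⟩ := hfz.exists_decomposition hSs hSc
  have hz : z = S g + Complex.I • a + -Complex.I • b := hfz.unique hSd
    (((IsAdjointPair.of_mem hSs g).add ha).add hb)
  have hg : ∀ {y w : H}, IsAdjointPair S y w → kreinForm J (S g) y = kreinForm J g w :=
    fun h => by
      rw [← kreinForm_conj_symm hJs, ← h.kreinForm_domain hJs hSJ g, kreinForm_conj_symm hJs]
  -- Both `g` and `b` satisfy the boundary condition at `y₁` identically; only `a` contributes, with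
  -- `-i [a, y₁] = i [a, y₁]`. The roles of `a` and `b` are exchanged at `y₂`.
  have e₁ : (kreinForm J z y₁ = kreinForm J (g + a + b) (Complex.I • y₁)) ↔
      kreinForm J a y₁ = 0 := by
    rw [hz]
    simp only [kreinForm_add_left, kreinForm_smul_left, hg hy₁, kreinForm_smul_right, map_neg,
      Complex.conj_I, neg_neg]
    constructor
    · intro h
      have : Complex.I * kreinForm J a y₁ = 0 := by linear_combination (-1 / 2 : ℂ) * h
      exact (mul_eq_zero.1 this).resolve_left Complex.I_ne_zero
    · intro h
      rw [h]; ring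
  have e₂ : (kreinForm J z y₂ = kreinForm J (g + a + b) (-Complex.I • y₂)) ↔
      kreinForm J b y₂ = 0 := by
    rw [hz]
    simp only [kreinForm_add_left, kreinForm_smul_left, hg hy₂, kreinForm_smul_right, map_neg,
      Complex.conj_I, neg_neg]
    constructor
    · intro h
      have : Complex.I * kreinForm J b y₂ = 0 := by linear_combination (1 / 2 : ℂ) * h
      exact (mul_eq_zero.1 this).resolve_left Complex.I_ne_zero
    · intro h
      rw [h]; ring
  constructor
  · intro hf
    obtain ⟨g', c, d, hf'⟩ := mem_sup_span_pair_iff.1 hf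
    rw [hf', ← add_assoc] at hfz ⊢
    have hz' : z = S g' + c • Complex.I • y₁ + d • -Complex.I • y₂ := hfz.unique hSd
      (((IsAdjointPair.of_mem hSs g').add ((mem_defectSpace.1 hy₁).smul c)).add ((mem_defectSpace.1 hy₂).smul d))
    have hg' : ∀ {y w : H}, IsAdjointPair S y w → kreinForm J (S g') y = kreinForm J g' w :=
      fun h => by
        rw [← kreinForm_conj_symm hJs, ← h.kreinForm_domain hJs hSJ g', kreinForm_conj_symm hJs]
    rw [hz']
    simp only [kreinForm_add_left, kreinForm_smul_left, hg' hy₁, hg' hy₂, kreinForm_smul_right,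
      map_neg, Complex.conj_I, neg_neg, hn₁, hn₂]
    constructor <;> ring
  · rintro ⟨h₁, h₂⟩
    obtain ⟨c, rfl⟩ := hs₁ a ha (e₁.1 h₁)
    obtain ⟨d, rfl⟩ := hs₂ b hb (e₂.1 h₂)
    exact mem_sup_span_pair_iff.2 ⟨g, c, d, by rw [add_assoc]⟩

theorem spanExtension_mem_sigmaJ (hSd : IsDenselyDefined S) (hSs : IsSymmetricOp S)
    (hSc : S.IsClosed) (hJJ : ∀ x, J (J x) = x)
    (hJs : ∀ x y, inner ℂ (J x) y = inner ℂ x (J y)) (hSJ : CommutesOnDomain S J)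
    (hy₁ : y₁ ∈ defectSpace S Complex.I) (hy₂ : y₂ ∈ defectSpace S (-Complex.I))
    (hn₁ : kreinForm J y₁ y₁ = 0) (hn₂ : kreinForm J y₂ y₂ = 0)
    (hs₁ : ∀ a ∈ defectSpace S Complex.I, kreinForm J a y₁ = 0 → ∃ c : ℂ, a = c • y₁)
    (hs₂ : ∀ a ∈ defectSpace S (-Complex.I), kreinForm J a y₂ = 0 → ∃ c : ℂ, a = c • y₂) :
    spanExtension S y₁ y₂ ∈ SigmaJ J S := by
  set A := spanExtension S y₁ y₂
  have hiff : ∀ {f z : H}, IsAdjointPair S f z → _ := fun {f z} =>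
    mem_spanExtension_domain_iff hSd hSs hSc hJs hSJ hy₁ hy₂ hn₁ hn₂ hs₁ hs₂ (f := f) (z := z)
  have hSA : ∀ g : S.domain, ((g : H), S g) ∈ A.graph := fun g =>
    (mem_graph_spanExtension hSd).2 ⟨Submodule.mem_sup_left g.2, IsAdjointPair.of_mem hSs g⟩
  have hle : S ≤ A := by
    refine LinearPMap.le_of_le_graph ?_
    rintro ⟨a, b⟩ hab
    obtain ⟨x, rfl, rfl⟩ := (LinearPMap.mem_graph_iff S).1 hab
    exact hSA x
  have hm₁ : (y₁, Complex.I • y₁) ∈ A.graph := (mem_graph_spanExtension hSd).2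
    ⟨Submodule.mem_sup_right (Submodule.subset_span (by simp)), hy₁⟩
  have hm₂ : (y₂, -Complex.I • y₂) ∈ A.graph := (mem_graph_spanExtension hSd).2
    ⟨Submodule.mem_sup_right (Submodule.subset_span (by simp)), hy₂⟩
  refine ⟨hle, hSd.mono hle.1, fun y z => ⟨fun hyz x => ?_, fun h => ?_⟩⟩
  · obtain ⟨hxK, hx⟩ := (mem_graph_spanExtension hSd).1 (A.mem_graph x)
    obtain ⟨hyK, hy⟩ := (mem_graph_spanExtension hSd).1 hyz
    obtain ⟨g, c, d, rfl⟩ := mem_sup_span_pair_iff.1 hyK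
    have hz : z = S g + (c • Complex.I • y₁ + d • -Complex.I • y₂) := hy.unique hSd
      ((IsAdjointPair.of_mem hSs g).add (((mem_defectSpace.1 hy₁).smul c).add ((mem_defectSpace.1 hy₂).smul d)))
    obtain ⟨h₁, h₂⟩ := (hiff hx).1 hxK
    rw [hz]
    simp only [kreinForm_add_right, kreinForm_smul_right c, kreinForm_smul_right d, h₁, h₂,
      hx.kreinForm_domain hJs hSJ g]
  · have h' : ∀ {x w : H}, (x, w) ∈ A.graph → kreinForm J w y = kreinForm J x z := by
      intro x w hxw
      obtain ⟨x', rfl, rfl⟩ := (LinearPMap.mem_graph_iff A).1 hxw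
      exact h x'
    -- Testing against `J s` with `s ∈ D(S)` turns the indefinite form into the Hilbert inner
    -- product, so `y ∈ D(S*)`. Testing against `y₁` and `y₂` below then yields the boundary
    -- conditions.
    have hyz : IsAdjointPair S y z := fun s => by
      obtain ⟨h1, h2⟩ := hSJ s
      have h3 := h' (hSA ⟨J s, h1⟩)
      rwa [h2, kreinForm, kreinForm, hJJ, hJJ] at h3
    refine (mem_graph_spanExtension hSd).2 ⟨(hiff hyz).2 ⟨?_, ?_⟩, hyz⟩
    · rw [← kreinForm_conj_symm hJs, ← h' hm₁, kreinForm_conj_symm hJs]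
    · rw [← kreinForm_conj_symm hJs, ← h' hm₂, kreinForm_conj_symm hJs]

theorem exists_mem_sigmaJ_resolventSetOp_eq_empty (hSd : IsDenselyDefined S)
    (hSs : IsSymmetricOp S) (hSc : S.IsClosed) (hJJ : ∀ x, J (J x) = x)
    (hJs : ∀ x y, inner ℂ (J x) y = inner ℂ x (J y)) (hSJ : CommutesOnDomain S J)
    (hy₁ : y₁ ∈ defectSpace S Complex.I) (hy₂ : y₂ ∈ defectSpace S (-Complex.I))
    (hn₁ : kreinForm J y₁ y₁ = 0) (hn₂ : kreinForm J y₂ y₂ = 0)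
    (hs₁ : ∀ a ∈ defectSpace S Complex.I, kreinForm J a y₁ = 0 → ∃ c : ℂ, a = c • y₁)
    (hs₂ : ∀ a ∈ defectSpace S (-Complex.I), kreinForm J a y₂ = 0 → ∃ c : ℂ, a = c • y₂)
    (hμ : ∀ μ : ℂ, μ.im ≠ 0 → ∃ f ∈ defectSpace S μ, f ≠ 0 ∧ kreinForm J f y₁ = 0 ∧
      kreinForm J f y₂ = 0) :
    ∃ A ∈ SigmaJ J S, resolventSetOp A = ∅ := by
  refine ⟨spanExtension S y₁ y₂, spanExtension_mem_sigmaJ hSd hSs hSc hJJ hJs hSJ hy₁ hy₂ hn₁ hn₂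
    hs₁ hs₂, resolventSetOp_eq_empty fun μ h => ?_⟩
  obtain ⟨f, hf, hf0, hf₁, hf₂⟩ := hμ μ h
  refine ⟨f, hf0, (mem_graph_spanExtension hSd).2
    ⟨(mem_spanExtension_domain_iff hSd hSs hSc hJs hSJ hy₁ hy₂ hn₁ hn₂ hs₁ hs₂ hf).2 ?_, hf⟩⟩
  simp only [kreinForm_smul_left, kreinForm_smul_right, hf₁, hf₂, mul_zero, and_self]

end Krein

/-! ### Extensions with empty resolvent set, and the resulting rigidity of `𝔘`. -/

section Krein

variable {H : Type*} [NormedAddCommGroup H] [InnerProductSpace ℂ H]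
variable {J B : H →L[ℂ] H} {S : H →ₗ.[ℂ] H}

theorem inner_eq_zero_of_eigen (hJs : ∀ x y, inner ℂ (J x) y = inner ℂ x (J y)) {p m : H}
    (hp : J p = (1 : ℂ) • p) (hm : J m = (-1 : ℂ) • m) : inner ℂ p m = 0 := by
  have h := hJs p m
  rw [hp, hm, inner_smul_left, inner_smul_right, map_one] at h
  linear_combination (1 / 2 : ℂ) * h

theorem kreinForm_add_add (hJs : ∀ x y, inner ℂ (J x) y = inner ℂ x (J y)) {p m p' m' : H}
    (hp : J p = (1 : ℂ) • p) (hm : J m = (-1 : ℂ) • m) (hp' : J p' = (1 : ℂ) • p')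
    (hm' : J m' = (-1 : ℂ) • m') :
    kreinForm J (p + m) (p' + m') = inner ℂ p p' - inner ℂ m m' := by
  have h1 : inner ℂ m p' = 0 := by
    rw [← inner_conj_symm, inner_eq_zero_of_eigen hJs hp' hm, map_zero]
  rw [kreinForm, map_add, hp, hm, inner_add_left, inner_add_right, inner_add_right,
    inner_smul_left, inner_smul_left, inner_smul_left, inner_smul_left,
    inner_eq_zero_of_eigen hJs hp hm', h1]
  simp
  ring

theorem SpansDefect.of_mem {ε μ : ℂ} {f g : H} (hf : SpansDefect J S ε μ f)
    (hg : g ∈ defectSpace S μ) (hJg : J g = ε • g) (hg0 : g ≠ 0) : SpansDefect J S ε μ g := by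
  refine ⟨hg0, hg, hJg, fun a ha hJa => ?_⟩
  obtain ⟨c, rfl⟩ := hf.span a ha hJa
  obtain ⟨d, rfl⟩ := hf.span g hg hJg
  have hd : d ≠ 0 := fun h => hg0 (by rw [h, zero_smul])
  exact ⟨c / d, by rw [smul_smul, div_mul_cancel₀ _ hd]⟩

theorem SpansDefect.normalize {ε μ : ℂ} {f : H} (hf : SpansDefect J S ε μ f) :
    ∃ g, SpansDefect J S ε μ g ∧ ‖g‖ = 1 := by
  have h0 : (‖f‖ : ℂ)⁻¹ ≠ 0 := by
    simpa using hf.ne_zero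
  refine ⟨(‖f‖ : ℂ)⁻¹ • f, hf.of_mem (Submodule.smul_mem _ _ hf.mem) ?_
    (smul_ne_zero h0 hf.ne_zero), ?_⟩
  · rw [map_smul, hf.apply_eq, smul_comm]
  · rw [norm_smul, norm_inv, Complex.norm_real, norm_norm,
      inv_mul_cancel₀ (norm_ne_zero_iff.2 hf.ne_zero)]

theorem kreinForm_add_self (hJs : ∀ x y, inner ℂ (J x) y = inner ℂ x (J y)) {μ : ℂ} {p m : H}
    (hp : SpansDefect J S 1 μ p) (hm : SpansDefect J S (-1) μ m) (hpm : ‖p‖ = ‖m‖) :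
    kreinForm J (p + m) (p + m) = 0 := by
  rw [kreinForm_add_add hJs hp.apply_eq hm.apply_eq hp.apply_eq hm.apply_eq,
    inner_self_eq_norm_sq_to_K, inner_self_eq_norm_sq_to_K, hpm, sub_self]

/-- In a two-dimensional defect space with signature `(1, 1)`, a nonzero neutral vector spans its
own `J`-orthogonal complement. -/
theorem exists_eq_smul_of_kreinForm_eq_zero (hJJ : ∀ x, J (J x) = x)
    (hJs : ∀ x y, inner ℂ (J x) y = inner ℂ x (J y)) (hSJ : CommutesOnDomain S J) {μ : ℂ}
    {p m : H} (hp : SpansDefect J S 1 μ p) (hm : SpansDefect J S (-1) μ m) (hpm : ‖p‖ = ‖m‖)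
    (a : H) (ha : a ∈ defectSpace S μ) (h : kreinForm J a (p + m) = 0) :
    ∃ c : ℂ, a = c • (p + m) := by
  obtain ⟨x, y, rfl⟩ := exists_eq_add hJJ hJs hSJ hp hm ha
  rw [kreinForm_add_add hJs (by rw [map_smul, hp.apply_eq, smul_comm])
    (by rw [map_smul, hm.apply_eq, smul_comm]) hp.apply_eq hm.apply_eq, inner_smul_left,
    inner_smul_left, inner_self_eq_norm_sq_to_K, inner_self_eq_norm_sq_to_K, hpm, ← sub_mul] at h
  have h1 : starRingEnd ℂ x - starRingEnd ℂ y = 0 :=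
    (mul_eq_zero.1 h).resolve_right (pow_ne_zero 2 (by simpa using hm.ne_zero))
  rw [← map_sub, map_eq_zero, sub_eq_zero] at h1
  exact ⟨x, by rw [← h1, smul_add]⟩

theorem exists_ne_zero_kreinForm_eq_zero {μ : ℂ} {p m : H} (hp : SpansDefect J S 1 μ p)
    (hm : SpansDefect J S (-1) μ m) (y : H) :
    ∃ f ∈ defectSpace S μ, f ≠ 0 ∧ kreinForm J f y = 0 := by
  by_cases h : kreinForm J p y = 0
  · exact ⟨p, hp.mem, hp.ne_zero, h⟩
  -- The conjugate appears because the form is conjugate-linear in its first argument.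
  · set c := -starRingEnd ℂ (kreinForm J m y / kreinForm J p y)
    refine ⟨c • p + m, Submodule.add_mem _ (Submodule.smul_mem _ _ hp.mem) hm.mem, ?_, ?_⟩
    · intro h0
      have h1 : m = -(c • p) := (neg_eq_of_add_eq_zero_right h0).symm
      have h2 := hm.apply_eq
      rw [h1, map_neg, map_smul, hp.apply_eq, one_smul, ← h1, neg_smul, one_smul] at h2
      have h3 : (2 : ℂ) • m = 0 := by rw [two_smul]; exact add_eq_zero_iff_eq_neg.2 h2
      exact hm.ne_zero ((smul_eq_zero.1 h3).resolve_left two_ne_zero)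
    · rw [kreinForm_add_left, kreinForm_smul_left, map_neg, Complex.conj_conj, neg_mul,
        div_mul_cancel₀ _ h, neg_add_cancel]

theorem HasDefectSquare.inner_eq_zero (hBs : ∀ x y, inner ℂ (B x) y = inner ℂ x (B y))
    {k k' : ℝ} (hk : k ≠ k') {μ ν : ℂ} (h : HasDefectSquare J B S k μ)
    (h' : HasDefectSquare J B S k' ν) {f g : H} (hf : f ∈ defectSpace S μ)
    (hg : g ∈ defectSpace S ν) : inner ℂ f g = 0 := by
  have h3 : inner ℂ f (B (B g)) = inner ℂ (B (B f)) g := by rw [hBs, hBs]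
  rw [h.2.2 f hf, h'.2.2 g hg, inner_smul_right, inner_smul_left, Complex.conj_ofReal] at h3
  by_contra h0
  exact hk (Complex.ofReal_injective (mul_right_cancel₀ h0 h3)).symm

theorem isAdjointPair_of_mem_sigmaJ (hJJ : ∀ x, J (J x) = x)
    (hSJ : CommutesOnDomain S J) {A : H →ₗ.[ℂ] H} (hA : A ∈ SigmaJ J S) (x : A.domain) :
    IsAdjointPair S x (A x) := fun s => by
  obtain ⟨h1, h2⟩ := hSJ s
  have h3 := (hA.2.2 x (A x)).1 (A.mem_graph x) ⟨J s, hA.1.1 h1⟩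
  have h4 : A ⟨J s, hA.1.1 h1⟩ = S ⟨J s, h1⟩ := (hA.1.2 rfl).symm
  rw [h4, h2, kreinForm, kreinForm, hJJ] at h3
  rwa [hJJ] at h3

variable [CompleteSpace H]

theorem exists_resolventSetOp_eq_empty_of_ne (hSd : IsDenselyDefined S)
    (hSs : IsSymmetricOp S) (hSc : S.IsClosed) (hJJ : ∀ x, J (J x) = x)
    (hJs : ∀ x y, inner ℂ (J x) y = inner ℂ x (J y)) (hSJ : CommutesOnDomain S J)
    (hBs : ∀ x y, inner ℂ (B x) y = inner ℂ x (B y)) {k k' : ℝ} (hkk' : k ≠ k')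
    (hk : ∀ μ : ℂ, 0 < μ.im → HasDefectSquare J B S k μ)
    (hk' : ∀ μ : ℂ, μ.im < 0 → HasDefectSquare J B S k' μ) :
    ∃ A ∈ SigmaJ J S, resolventSetOp A = ∅ := by
  have hI := hk Complex.I (by simp)
  have hI' := hk' (-Complex.I) (by simp)
  obtain ⟨⟨p, hp⟩, ⟨m, hm⟩, -⟩ := id hI
  obtain ⟨⟨p', hp'⟩, ⟨m', hm'⟩, -⟩ := id hI'
  obtain ⟨p₁, hp₁, hp₁n⟩ := hp.normalize
  obtain ⟨m₁, hm₁, hm₁n⟩ := hm.normalize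
  obtain ⟨p₂, hp₂, hp₂n⟩ := hp'.normalize
  obtain ⟨m₂, hm₂, hm₂n⟩ := hm'.normalize
  have h₁ : ‖p₁‖ = ‖m₁‖ := hp₁n.trans hm₁n.symm
  have h₂ : ‖p₂‖ = ‖m₂‖ := hp₂n.trans hm₂n.symm
  have hy₁ := Submodule.add_mem _ hp₁.mem hm₁.mem
  have hy₂ := Submodule.add_mem _ hp₂.mem hm₂.mem
  refine exists_mem_sigmaJ_resolventSetOp_eq_empty hSd hSs hSc hJJ hJs hSJ hy₁ hy₂
    (kreinForm_add_self hJs hp₁ hm₁ h₁) (kreinForm_add_self hJs hp₂ hm₂ h₂)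
    (exists_eq_smul_of_kreinForm_eq_zero hJJ hJs hSJ hp₁ hm₁ h₁)
    (exists_eq_smul_of_kreinForm_eq_zero hJJ hJs hSJ hp₂ hm₂ h₂) fun μ hμ => ?_
  rcases lt_or_gt_of_ne hμ with hneg | hpos
  · obtain ⟨⟨p, hp⟩, ⟨m, hm⟩, -⟩ := id (hk' μ hneg)
    obtain ⟨f, hf, hf0, hfy⟩ := exists_ne_zero_kreinForm_eq_zero hp hm (p₂ + m₂)
    exact ⟨f, hf, hf0, (hk' μ hneg).inner_eq_zero hBs hkk'.symm hI
      (defectSpace_map hSJ hJs hf) hy₁, hfy⟩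
  · obtain ⟨⟨p, hp⟩, ⟨m, hm⟩, -⟩ := id (hk μ hpos)
    obtain ⟨f, hf, hf0, hfy⟩ := exists_ne_zero_kreinForm_eq_zero hp hm (p₁ + m₁)
    exact ⟨f, hf, hf0, hfy, (hk μ hpos).inner_eq_zero hBs hkk' hI'
      (defectSpace_map hSJ hJs hf) hy₂⟩

theorem exists_resolventSetOp_eq_empty_of_pos (hSd : IsDenselyDefined S)
    (hSs : IsSymmetricOp S) (hSc : S.IsClosed) (hJJ : ∀ x, J (J x) = x)
    (hJs : ∀ x y, inner ℂ (J x) y = inner ℂ x (J y)) (hSJ : CommutesOnDomain S J)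
    (hBs : ∀ x y, inner ℂ (B x) y = inner ℂ x (B y)) (hSB : CommutesOnDomain S B)
    (hJB : ∀ x, J (B x) = -B (J x)) {k : ℝ} (hk0 : 0 < k)
    (hk : ∀ μ : ℂ, μ.im ≠ 0 → HasDefectSquare J B S k μ) :
    ∃ A ∈ SigmaJ J S, resolventSetOp A = ∅ := by
  set r : ℝ := (√k)⁻¹ with hr
  have hrk : r * r * k = 1 := by
    rw [hr, ← mul_inv, Real.mul_self_sqrt hk0.le, inv_mul_cancel₀ hk0.ne']
  have hkC : (k : ℂ) ≠ 0 := by exact_mod_cast hk0.ne'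
  have hrC : (r : ℂ) ≠ 0 := by
    rintro h
    rw [Complex.ofReal_eq_zero] at h
    rw [h] at hrk
    norm_num at hrk
  have hspan : ∀ μ : ℂ, μ.im ≠ 0 → ∃ m, SpansDefect J S (-1) μ m ∧
      SpansDefect J S 1 μ ((r : ℂ) • B m) := fun μ hμ => by
    obtain ⟨⟨p, hp⟩, ⟨m, hm⟩, hB⟩ := hk μ hμ
    refine ⟨m, hm, hp.of_mem (Submodule.smul_mem _ _ (defectSpace_map hSB hBs hm.mem)) ?_ ?_⟩
    · rw [map_smul, hJB, hm.apply_eq, map_smul]; module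
    · intro h0
      have h1 : B m = 0 := (smul_eq_zero.1 h0).resolve_left hrC
      have h2 := hB m hm.mem
      rw [h1, map_zero] at h2
      exact smul_ne_zero hkC hm.ne_zero h2.symm
  -- Only `m'` has to lie in a defect space, so the identity also pairs vectors from defect spaces
  -- at different points.
  have hin : ∀ (μ : ℂ), μ.im ≠ 0 → ∀ m' ∈ defectSpace S μ, ∀ m : H,
      inner ℂ ((r : ℂ) • B m) ((r : ℂ) • B m') = inner ℂ m m' := fun μ hμ m' hm' m => by
    rw [inner_smul_left, inner_smul_right, hBs, (hk μ hμ).2.2 m' hm', inner_smul_right,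
      Complex.conj_ofReal, ← mul_assoc, ← mul_assoc]
    rw [show (r : ℂ) * r * k = ((r * r * k : ℝ) : ℂ) by push_cast; rfl, hrk]
    simp
  have hIim : (Complex.I).im ≠ 0 := by simp
  have hIim' : (-Complex.I).im ≠ 0 := by simp
  obtain ⟨m₁, hm₁, hp₁⟩ := hspan Complex.I hIim
  obtain ⟨m₂, hm₂, hp₂⟩ := hspan (-Complex.I) hIim'
  have hnorm : ∀ (μ : ℂ), μ.im ≠ 0 → ∀ m ∈ defectSpace S μ, ‖(r : ℂ) • B m‖ = ‖m‖ :=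
    fun μ hμ m hm => by
      rw [@norm_eq_sqrt_re_inner ℂ, @norm_eq_sqrt_re_inner ℂ _ _ _ _ m, hin μ hμ m hm]
  have h₁ := hnorm _ hIim m₁ hm₁.mem
  have h₂ := hnorm _ hIim' m₂ hm₂.mem
  refine exists_mem_sigmaJ_resolventSetOp_eq_empty hSd hSs hSc hJJ hJs hSJ
    (Submodule.add_mem _ hp₁.mem hm₁.mem) (Submodule.add_mem _ hp₂.mem hm₂.mem)
    (kreinForm_add_self hJs hp₁ hm₁ h₁) (kreinForm_add_self hJs hp₂ hm₂ h₂)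
    (exists_eq_smul_of_kreinForm_eq_zero hJJ hJs hSJ hp₁ hm₁ h₁)
    (exists_eq_smul_of_kreinForm_eq_zero hJJ hJs hSJ hp₂ hm₂ h₂) fun μ hμ => ?_
  obtain ⟨m, hm, hp⟩ := hspan μ hμ
  -- By `hin` the positive and negative parts contribute equal amounts to the pairing with `y₁` and
  -- with `y₂`, and they cancel.
  refine ⟨(r : ℂ) • B m + m, Submodule.add_mem _ hp.mem hm.mem, ?_, ?_, ?_⟩
  · intro h0
    have h3 := congrArg (fun w => inner ℂ w m) h0
    simp only [inner_add_left, inner_zero_left] at h3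
    rw [inner_eq_zero_of_eigen hJs hp.apply_eq hm.apply_eq, zero_add, inner_self_eq_zero] at h3
    exact hm.ne_zero h3
  · rw [kreinForm_add_add hJs hp.apply_eq hm.apply_eq hp₁.apply_eq hm₁.apply_eq,
      hin _ hIim m₁ hm₁.mem, sub_self]
  · rw [kreinForm_add_add hJs hp.apply_eq hm.apply_eq hp₂.apply_eq hm₂.apply_eq,
      hin _ hIim' m₂ hm₂.mem, sub_self]

/-- If every `J`-self-adjoint extension has a non-empty resolvent set, an operator `B` commuting
with `S` and anticommuting with `J` vanishes on the defect subspaces. -/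
theorem apply_defect_eq_zero (hSd : IsDenselyDefined S)
    (hSs : IsSymmetricOp S) (hSc : S.IsClosed) (hJJ : ∀ x, J (J x) = x)
    (hJs : ∀ x y, inner ℂ (J x) y = inner ℂ x (J y)) (hSJ : CommutesOnDomain S J)
    (hBs : ∀ x y, inner ℂ (B x) y = inner ℂ x (B y)) (hSB : CommutesOnDomain S B)
    (hJB : ∀ x, J (B x) = -B (J x))
    (hdef_plus : HasDeficiencyIndices (part S (plusSpace J)) 1 1)
    (hdef_minus : HasDeficiencyIndices (part S (minusSpace J)) 1 1)
    (hres : ∀ A ∈ SigmaJ J S, resolventSetOp A ≠ ∅) :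
    ∀ μ : ℂ, μ.im ≠ 0 → ∀ f ∈ defectSpace S μ, B f = 0 := by
  have hline : ∀ ν : ℂ, Module.rank ℂ (defectSpace (part S (plusSpace J)) ν) = (1 : ℕ) →
      Module.rank ℂ (defectSpace (part S (minusSpace J)) ν) = (1 : ℕ) →
      ∃ k : ℝ, 0 ≤ k ∧ HasDefectSquare J B S k ν := fun ν h1 h2 => by
    obtain ⟨p, hp⟩ := exists_spansDefect hJJ hJs hSJ (by norm_num) (by simp)
      (mem_plusSpace_iff hJJ) (by simpa using h1)
    obtain ⟨m, hm⟩ := exists_spansDefect hJJ hJs hSJ (by norm_num) (by simp)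
      (mem_minusSpace_iff hJJ) (by simpa using h2)
    exact exists_hasDefectSquare hJJ hJs hSJ hBs hSB hJB hp hm
  obtain ⟨k, hk0, hk⟩ := hline _ hdef_plus.1 hdef_minus.1
  obtain ⟨k', hk0', hk'⟩ := hline _ hdef_plus.2 hdef_minus.2
  have hU : ∀ μ : ℂ, 0 < μ.im → HasDefectSquare J B S k μ := fun μ hμ =>
    hk.of_isPreconnected hJJ hJs hSs hSc hSJ hBs hSB hJB
      (convex_halfSpace_im_gt 0).isPreconnected (fun _ h => ne_of_gt h) (by simp) hμ
  have hL : ∀ μ : ℂ, μ.im < 0 → HasDefectSquare J B S k' μ := fun μ hμ =>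
    hk'.of_isPreconnected hJJ hJs hSs hSc hSJ hBs hSB hJB
      (convex_halfSpace_im_lt 0).isPreconnected (fun _ h => ne_of_lt h) (by simp) hμ
  have hkk' : k = k' := by
    by_contra hne
    obtain ⟨A, hA, hA'⟩ := exists_resolventSetOp_eq_empty_of_ne hSd hSs hSc hJJ hJs hSJ hBs hne
      hU hL
    exact hres A hA hA'
  subst hkk'
  have hall : ∀ μ : ℂ, μ.im ≠ 0 → HasDefectSquare J B S k μ := fun μ hμ =>
    (lt_or_gt_of_ne hμ).elim (hL μ) (hU μ)
  have hk00 : k = 0 := by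
    by_contra hne
    obtain ⟨A, hA, hA'⟩ := exists_resolventSetOp_eq_empty_of_pos hSd hSs hSc hJJ hJs hSJ hBs hSB
      hJB (lt_of_le_of_ne hk0 (Ne.symm hne)) hall
    exact hres A hA hA'
  intro μ hμ f hf
  have h1 := (hall μ hμ).2.2 f hf
  rw [hk00, Complex.ofReal_zero, zero_smul] at h1
  rw [← inner_self_eq_zero (𝕜 := ℂ), hBs, h1, inner_zero_right]

theorem apply_eq_apply_of_mem_uSet (hSd : IsDenselyDefined S)
    (hSs : IsSymmetricOp S) (hSc : S.IsClosed) (hJJ : ∀ x, J (J x) = x)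
    (hJs : ∀ x y, inner ℂ (J x) y = inner ℂ x (J y)) (hSJ : CommutesOnDomain S J)
    (hdef_plus : HasDeficiencyIndices (part S (plusSpace J)) 1 1)
    (hdef_minus : HasDeficiencyIndices (part S (minusSpace J)) 1 1)
    (hres : ∀ A ∈ SigmaJ J S, resolventSetOp A ≠ ∅) {C : H →L[ℂ] H} (hC : C ∈ USet J S) {μ : ℂ}
    (hμ : μ.im ≠ 0) {f : H} (hf : f ∈ defectSpace S μ) : C f = J f := by
  obtain ⟨hCC, ⟨hpos, hstrict⟩, hSC⟩ := hC
  have hCC' : ∀ x, C (C x) = x := fun x => congrArg (fun L : H →L[ℂ] H => L x) hCC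
  have hSC' := hSC.commutesOnDomain
  have hG : ∀ x y, inner ℂ (J (C x)) y = inner ℂ x (J (C y)) := fun x y => hpos.isSymmetric x y
  -- `C J` inherits symmetry as the inverse of the symmetric operator `J C`.
  have hG' : ∀ x y, inner ℂ (C (J x)) y = inner ℂ x (C (J y)) := fun x y => by
    have h := hG (C (J x)) (C (J y))
    rw [hCC', hJJ, hCC', hJJ] at h
    exact h.symm
  have hB := apply_defect_eq_zero (B := J * C - C * J) hSd hSs hSc hJJ hJs hSJ
    (fun x y => by
      change inner ℂ (J (C x) - C (J x)) y = inner ℂ x (J (C y) - C (J y))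
      rw [inner_sub_left, inner_sub_right, hG, hG'])
    ((hSJ.mul hSC').sub (hSC'.mul hSJ))
    (fun x => by
      change J (J (C x) - C (J x)) = -(J (C (J x)) - C (J (J x)))
      rw [map_sub, hJJ, hJJ]; abel)
    hdef_plus hdef_minus hres μ hμ
  have hGf : J (C f) = C (J f) := sub_eq_zero.1 (hB f hf)
  have hG2 : J (C (J (C f))) = f := by rw [hGf, hCC', hJJ]
  -- On `f` the operator `J C` squares to the identity, so `J C f - f` is an eigenvector for `-1`
  -- unless it is zero, which strict positivity forbids otherwise.
  have h0 : J (C f) - f = 0 := by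
    by_contra hne
    have h1 := hstrict _ hne
    have h2 : (J * C) (J (C f) - f) = -(J (C f) - f) := by
      change J (C (J (C f) - f)) = _
      rw [map_sub, map_sub, hG2]; abel
    rw [h2, inner_neg_left, inner_self_eq_norm_sq_to_K] at h1
    have h3 : ((‖J (C f) - f‖ : ℂ) ^ 2) = ((‖J (C f) - f‖ ^ 2 : ℝ) : ℂ) := by push_cast; rfl
    erw [h3] at h1
    rw [Complex.neg_re, Complex.ofReal_re] at h1
    nlinarith [sq_nonneg ‖J (C f) - f‖]
  rw [← hJJ (C f), sub_eq_zero.1 h0]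

/-- A `J`-self-adjoint extension commuting with `K` commutes with every involution `L` that agrees
with `K` on the defect subspaces. -/
theorem CommutesWith.of_eq_on_defect (hSd : IsDenselyDefined S)
    (hSs : IsSymmetricOp S) (hSc : S.IsClosed) (hJJ : ∀ x, J (J x) = x)
    (hSJ : CommutesOnDomain S J) {A : H →ₗ.[ℂ] H} (hA : A ∈ SigmaJ J S) {K L L' : H →L[ℂ] H}
    (hSK : CommutesOnDomain S K) (hSL : CommutesOnDomain S L) (hSL' : CommutesOnDomain S L')
    (hLL' : ∀ x y, inner ℂ (L' x) y = inner ℂ x (L y)) (hL2 : ∀ x, L (L x) = x)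
    (h₁ : ∀ f ∈ defectSpace S Complex.I, L f = K f)
    (h₂ : ∀ f ∈ defectSpace S (-Complex.I), L f = K f) (hAK : CommutesWith A K) :
    CommutesWith A L := by
  have hmem : ∀ x ∈ A.domain, L x ∈ A.domain := fun x hx => by
    obtain ⟨g, a, ha, b, hb, hxg⟩ :=
      (isAdjointPair_of_mem_sigmaJ hJJ hSJ hA ⟨x, hx⟩).exists_decomposition hSs hSc
    have hxg' : x = g + a + b := hxg
    -- On `D(S*)` the difference `L - K` sees only the component `g ∈ D(S)`.
    have hLK : L x = K x + (L g - K g) := by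
      rw [hxg', map_add, map_add, map_add, map_add, h₁ a ha, h₂ b hb]; abel
    rw [hLK]
    exact A.domain.add_mem ((hAK.1 x).2 hx)
      (A.domain.sub_mem (hA.1.1 (hSL g).1) (hA.1.1 (hSK g).1))
  refine ⟨fun x => ⟨fun h => hL2 x ▸ hmem _ h, hmem x⟩, fun x hx hLx => ?_⟩
  -- Both values equal `S* (L x)`: the adjoint `L'` of `L` commutes with `S`, so `L` commutes with
  -- `S*` on its domain.
  exact (isAdjointPair_of_mem_sigmaJ hJJ hSJ hA ⟨L x, hLx⟩).unique hSd
    ((isAdjointPair_of_mem_sigmaJ hJJ hSJ hA ⟨x, hx⟩).map hSL' hLL')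

end Krein

end KreinExt

theorem theorem4p1 {H : Type*} [NormedAddCommGroup H] [InnerProductSpace ℂ H] [CompleteSpace H]
    (J : H →L[ℂ] H) (hJ : KreinExt.IsNontrivialFundamentalSymmetry J)
    (S : H →ₗ.[ℂ] H) (hSdense : KreinExt.IsDenselyDefined S) (hSclosed : S.IsClosed)
    (hSsymm : KreinExt.IsSymmetricOp S) (hSJ : KreinExt.CommutesWith S J)
    (hdef_plus :
      KreinExt.HasDeficiencyIndices (KreinExt.part S (KreinExt.plusSpace J)) 1 1)
    (hdef_minus :
      KreinExt.HasDeficiencyIndices (KreinExt.part S (KreinExt.minusSpace J)) 1 1)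
    (hres : ∀ A ∈ KreinExt.SigmaJ J S, KreinExt.resolventSetOp A ≠ ∅) :
    (KreinExt.UpsilonU J S = KreinExt.UpsilonJ J S ∧
      KreinExt.UpsilonJ J S = KreinExt.SigmaJst J S) ∧
    (KreinExt.IsSimpleOp S → KreinExt.USet J S = {J}) := by
  have hJJ : ∀ x, J (J x) = x := fun x => congrArg (fun L : H →L[ℂ] H => L x) hJ.sq
  have hJs : ∀ x y, inner ℂ (J x) y = inner ℂ x (J y) := fun x y => hJ.selfAdjoint.isSymmetric x y
  have hSJ' := hSJ.commutesOnDomain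
  have hJU : J ∈ KreinExt.USet J S := by
    refine ⟨hJ.sq, ⟨?_, fun x hx => ?_⟩, hSJ⟩
    · rw [hJ.sq]; exact ContinuousLinearMap.isPositive_one
    · rw [hJ.sq]
      exact (inner_self_nonneg (𝕜 := ℂ)).lt_of_ne fun h => hx (inner_self_eq_zero.1
        (by rw [← inner_self_ofReal_re (𝕜 := ℂ)]; exact congrArg _ h.symm))
  have hCJ : ∀ C ∈ KreinExt.USet J S, ∀ μ : ℂ, μ.im ≠ 0 →
      ∀ f ∈ KreinExt.defectSpace S μ, C f = J f := fun C hC μ hμ f hf =>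
    KreinExt.apply_eq_apply_of_mem_uSet hSdense hSsymm hSclosed hJJ hJs hSJ' hdef_plus hdef_minus
      hres hC hμ hf
  have hIim : (Complex.I).im ≠ 0 := by simp
  have hIim' : (-Complex.I).im ≠ 0 := by simp
  have htoJ : ∀ A ∈ KreinExt.SigmaJ J S, ∀ C ∈ KreinExt.USet J S, KreinExt.CommutesWith A C →
      KreinExt.CommutesWith A J := fun A hA C hC hAC =>
    KreinExt.CommutesWith.of_eq_on_defect hSdense hSsymm hSclosed hJJ hSJ' hA
      hC.2.2.commutesOnDomain hSJ' hSJ' hJs hJJ (fun f hf => (hCJ C hC _ hIim f hf).symm)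
      (fun f hf => (hCJ C hC _ hIim' f hf).symm) hAC
  have hofJ : ∀ A ∈ KreinExt.SigmaJ J S, ∀ C ∈ KreinExt.USet J S, KreinExt.CommutesWith A J →
      KreinExt.CommutesWith A C := fun A hA C hC hAJ => by
    have hSC := hC.2.2.commutesOnDomain
    -- Self-adjointness of `J C` makes `J C J` the Hilbert adjoint of `C`.
    refine KreinExt.CommutesWith.of_eq_on_defect (L' := J * C * J) hSdense hSsymm hSclosed hJJ
      hSJ' hA hSJ' hSC ((hSJ'.mul hSC).mul hSJ') (fun x y => ?_)
      (fun x => congrArg (fun L : H →L[ℂ] H => L x) hC.1) (hCJ C hC _ hIim) (hCJ C hC _ hIim') hAJ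
    have h1 : inner ℂ (J (C (J x))) y = inner ℂ (J x) (J (C y)) :=
      hC.2.1.1.isSymmetric (J x) y
    change inner ℂ (J (C (J x))) y = _
    rw [h1, hJs, hJJ]
  refine ⟨⟨Set.ext fun A => ⟨fun h => ⟨h.1, h.2 J hJU⟩,
    fun h => ⟨h.1, fun C hC => hofJ A h.1 C hC h.2⟩⟩, Set.ext fun A => ⟨fun h => ⟨h.1, J, hJU, h.2⟩,
    fun ⟨hA, C, hC, hAC⟩ => ⟨hA, htoJ A hA C hC hAC⟩⟩⟩, fun hsimple => ?_⟩
  refine Set.eq_singleton_iff_unique_mem.2 ⟨hJU, fun C hC => sub_eq_zero.1 ?_⟩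
  refine hsimple.eq_zero_of_commutes hSsymm hSclosed (hC.2.2.commutesOnDomain.sub hSJ')
    (fun f hf => ?_) (fun f hf => ?_)
  · exact sub_eq_zero.2 (hCJ C hC _ hIim f hf)
  · exact sub_eq_zero.2 (hCJ C hC _ hIim' f hf)
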